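/- **Setting.** Vectors carry the $\ell_2$ norm. Let $B_{nyq},B_{band}>0$ with $J=B_{nyq}/B_{band}$ a positive integer, $0<T_s\le 1/B_{nyq}$, and $W=B_{band}T_s/2<\tfrac12$. For $N\ge1$ let $s^{(0)},\dots,s^{(N-1)}$ be the discrete prolate spheroidal sequences (DPSS's): real sequences on $\mathbb Z$ with $\mathcal B_W(\mathcal T_N s^{(\ell)})=\lambda^{(\ell)}_{N,W}s^{(\ell)}$, $\lambda^{(0)}_{N,W}>\dots>\lambda^{(N-1)}_{N,W}$ and $\|\mathcal T_Ns^{(\ell)}\|=1$, where $\mathcal T_N$ sets all entries outside $\{0,\dots,N-1\}$ to zero and $\mathcal B_W$ restricts the discrete-time Fourier transform to $|f|\le W$. For $1\le k\le N$ the multiband modulated DPSS dictionary is the $N\times kJ$ matrix $\Psi=[\Psi_0\cdots\Psi_{J-1}]$, where column $\ell\in\{0,\dots,k-1\}$ of $\Psi_i$ is $\big(e^{j2\pi f_in}s^{(\ell)}[n]\big)_{0\le n<N}$ with $f_i=\big(-\tfrac{B_{nyq}}2+(i+\tfrac12)B_{band}\big)T_s$. A vector $\alpha\in\mathbb C^{kJ}$,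 split into $J$ blocks of length $k$, is $K$-block-sparse if it vanishes outside some $K$ blocks. An $M\times N$ real random matrix $A$ is subgaussian with constant $c_0>0$ if its entries are i.i.d. with mean $0$, variance $1/M$, and $\mathbb E\,e^{t\sqrt M A[m,n]}\le e^{c_0^2t^2}$ for all $t\in\mathbb R$. *BBCoSaMP.* For a dictionary $\Phi$ with $J$ blocks of columns, $\mathcal S_\Phi(x,K)$ is a set $\mathcal I$ of at most $K$ blocks minimizing the distance from $x$ to the range of $\Phi_{\mathcal I}$ (ties broken arbitrarily), and $\mathcal P_\Phi(x,K)$ is the projection of $x$ onto that range. BBCoSaMP$(B,\Phi,y,K)$ starts from $x^0=0$ and, until a stopping criterion is met, repeats: $r^\ell=y-Bx^\ell$; $h^\ell=B^Hr^\ell$; $\tilde{\mathcal I}=\mathcal S_\Phi(\mathcal P_\Phi(h^\ell,2K),2K)$; $\mathcal I=\mathcal S_\Phi(x^\ell,K)\cup\tilde{\mathcal I}$; $\tilde x$ minimizes $\|y-Bz\|$ over $z$ in the range of $\Phi_{\mathcal I}$; $x^{\ell+1}=\mathcal P_\Phi(\tilde x,K)$. The output is $x^\ell$ for the first $\ell$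 at which the criterion, a condition on $(\ell,x^\ell,r^\ell)$, is met. For a signal $\alpha'$ and noise $e$, call a criterion *adequate with constants* $\tau,\theta$ if (a) from some iteration on it is met whenever $\|r^\ell\|\le\tau\|e\|$, and (b) it is met only if $\|r^\ell\|\le\theta\|e\|$ or $\|\alpha'\|\le\theta\,2^\ell\|e\|$. (Example: stop as soon as $\|r^\ell\|\le\tau\|e\|$.) **Theorem.** 1. There is a constant $C_1>0$ such that for all $W\in(0,\frac12)$ and $\epsilon\in(0,1)$ there are $C_2>0$ and $N_0$ with $$\lambda^{(\ell)}_{N,W}\ge1-C_1e^{-C_2N}\quad\text{for all }\ell\in\{0,\dots,N-1\}\text{ with }\ell\le2NW(1-\epsilon)\text{ and all }N\ge N_0.\tag{1}$$ 2. For all $c_0,\eta>0$ there is $c_1(\eta)>0$, depending only on $\eta$ and $c_0$, such that every $M\times N$ subgaussian matrix $A$ with constant $c_0$ satisfies, for all $0\ne x\in\mathbb C^N$, $$\mathbb P\big(\big|\|Ax\|^2-\|x\|^2\big|\ge\eta\|x\|^2\big)\le4e^{-c_1(\eta)M}.\tag{2}$$ 3. There are an absolute constant $\tau_0>0$ and a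 function $\kappa_2>1$ of two real variables such that the following holds. Let $\epsilon\in(0,1)$, let $C_1,C_2>0$ and $N_0$ be any constants satisfying (1) for $W=B_{band}T_s/2$ and this $\epsilon$, let $N\ge\max(N_0,1)$ be such that $k=2NW(1-\epsilon)$ is an integer (so $D=kJ=N(1-\epsilon)B_{nyq}T_s<N$), and let $\Psi$ be the $N\times D$ multiband modulated DPSS dictionary. Let $1\le K\le J$, $0<\delta<0.1-6NC_1^{1/2}e^{-C_2N/2}$ and $\beta\in(0,1)$. Let $A$ be an $M\times N$ subgaussian matrix, let $c_1(\delta/\sqrt2)>0$ satisfy (2) for $A$ with $\eta=\delta/\sqrt2$, and let $$M\ge\frac{8K\left(\frac DJ\log(42/\delta)+\log(eJ/4K)\right)+\log(4/\beta)}{c_1(\delta/\sqrt2)}.$$ Then with probability exceeding $1-\beta$ the following statement holds: for every $K$-block-sparse $\alpha'\in\mathbb C^D$, with $x'=\Psi\alpha'$, every $e\in\mathbb C^M$ and $y=Ax'+e$, and every stopping criterion adequate for $\alpha',e$ with constants $\tau\ge\tau_0$ and $\theta$, BBCoSaMP$(A\Psi,I,y,K)$ terminates, and each of its outputs $\widehat\alpha$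 (for any tie-breaking) satisfies $$\|\alpha'-\widehat\alpha\|\le\kappa_2\|e\|,\qquad\kappa_2=\kappa_2\big(\delta+6NC_1^{1/2}e^{-C_2N/2},\ \theta\big),$$ so that $\kappa_2$ is determined by the block-RIP constant of $A\Psi$ and the stopping criterion. -/

import Mathlib

open MeasureTheory ProbabilityTheory
open scoped Matrix

universe u

noncomputable section

namespace DPSSRecovery

/-! ### Discrete prolate spheroidal sequences -/

/-- The time-limiting operator: zero out all entries with index outside `{0, …, N-1}`. -/
def timeLimit (N : ℕ) (x : ℤ → ℂ) : ℤ → ℂ :=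
  fun n => if 0 ≤ n ∧ n < (N : ℤ) then x n else 0

/-- The discrete-time Fourier transform `X(f) = ∑ₙ x[n] e^{-j2πfn}`
(only applied below to finitely supported sequences). -/
def dtft (x : ℤ → ℂ) (f : ℝ) : ℂ :=
  ∑' n : ℤ, x n * Complex.exp (-(2 * Real.pi * f * n * Complex.I))

/-- The band-limiting operator: restrict the DTFT to `|f| ≤ W` and return to the time domain. -/
def bandLimit (W : ℝ) (x : ℤ → ℂ) : ℤ → ℂ :=
  fun m => ∫ f in (-W)..W, dtft x f * Complex.exp (2 * Real.pi * f * m * Complex.I)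

/-- `s 0, …, s (N-1)` are the discrete prolate spheroidal sequences with parameters `N`, `W`, with
eigenvalues `lam 0 ≥ ⋯ ≥ lam (N-1)`.  That the eigenvalues are in fact pairwise distinct and lie
strictly between `0` and `1` is a theorem and is not demanded here; the orthogonality of the
time-limited sequences is automatic for distinct eigenvalues. -/
structure IsDPSS (N : ℕ) (W : ℝ) (lam : Fin N → ℝ) (s : Fin N → ℤ → ℝ) : Prop where
  eigen : ∀ (l : Fin N) (m : ℤ),
    bandLimit W (timeLimit N fun n => (s l n : ℂ)) m = (lam l : ℂ) * (s l m : ℂ)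
  antitone : Antitone lam
  normalized : ∀ l : Fin N, ∑ n : Fin N, s l (n : ℤ) ^ 2 = 1
  orthogonal : ∀ l l' : Fin N, l ≠ l' → ∑ n : Fin N, s l (n : ℤ) * s l' (n : ℤ) = 0

/-- The constants `C₁`, `C₂` and the integer `N₀` quantify the clustering of the first
`2NW(1-ε)` eigenvalues near one. -/
def EigenvaluesNearOne (W ε C₁ C₂ : ℝ) (N₀ : ℕ) : Prop :=
  ∀ N : ℕ, N₀ ≤ N → ∀ (lam : Fin N → ℝ) (s : Fin N → ℤ → ℝ), IsDPSS N W lam s →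
    ∀ l : Fin N, ((l : ℕ) : ℝ) ≤ 2 * N * W * (1 - ε) →
      1 - C₁ * Real.exp (-(C₂ * N)) ≤ lam l

/-! ### The multiband modulated DPSS dictionary -/

/-- The midpoint `F_i = -B_nyq/2 + (i + 1/2) B_band` of the `i`-th band. -/
def bandCenter (Bnyq Bband : ℝ) (i : ℕ) : ℝ := -(Bnyq / 2) + (i + 1 / 2) * Bband

/-- The dictionary `[Ψ₀ Ψ₁ ⋯ Ψ_{J-1}]`, where `Ψ_i` consists of the first `k` DPSS vectors, modulated
to the digital frequency `F_i T_s`.  The column `(i, l)` is the `l`-th column of the block `i`. -/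
def dpssDictionary {N : ℕ} (s : Fin N → ℤ → ℝ) (J k : ℕ) (hk : k ≤ N) (Bnyq Bband Ts : ℝ) :
    Matrix (Fin N) (Fin J × Fin k) ℂ :=
  Matrix.of fun n p =>
    Complex.exp (2 * Real.pi * ((bandCenter Bnyq Bband p.1 * Ts : ℝ) : ℂ) * (n : ℕ) * Complex.I) *
      (s (Fin.castLE hk p.2) ((n : ℕ) : ℤ) : ℂ)

/-! ### Subgaussian random matrices -/

section Random

variable {Ω : Type*} [MeasurableSpace Ω] {M N : ℕ}

/-- A random real `M × N` matrix with i.i.d. entries of mean `0` and variance `1/M` whose normalized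
entries `√M A[m,n]` satisfy the subgaussian moment bound with constant `c₀`. -/
structure IsSubgaussianMatrix (μ : Measure Ω) (c₀ : ℝ) (A : Ω → Matrix (Fin M) (Fin N) ℝ) :
    Prop where
  measurable : ∀ m n, Measurable fun ω => A ω m n
  indep : iIndepFun (fun (p : Fin M × Fin N) ω => A ω p.1 p.2) μ
  ident : ∀ p q : Fin M × Fin N,
    IdentDistrib (fun ω => A ω p.1 p.2) (fun ω => A ω q.1 q.2) μ μ
  mean : ∀ m n, ∫ ω, A ω m n ∂μ = 0
  variance : ∀ m n, ∫ ω, A ω m n ^ 2 ∂μ = 1 / (M : ℝ)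
  mgf_integrable : ∀ m n (t : ℝ), Integrable (fun ω => Real.exp (√(M : ℝ) * A ω m n * t)) μ
  mgf_le : ∀ m n (t : ℝ),
    ∫ ω, Real.exp (√(M : ℝ) * A ω m n * t) ∂μ ≤ Real.exp (c₀ ^ 2 * t ^ 2)

/-- A real matrix viewed as a complex one. -/
def toComplex {m n : Type*} (A : Matrix m n ℝ) : Matrix m n ℂ := A.map fun a : ℝ => (a : ℂ)

/-- Matrix-vector multiplication between Euclidean spaces (`ℓ²` norms). -/
def mulE {m n : Type*} [Fintype n] (A : Matrix m n ℂ) (x : EuclideanSpace ℂ n) :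
    EuclideanSpace ℂ m :=
  WithLp.toLp 2 (A *ᵥ x.ofLp)

/-- `‖A x‖²` concentrates about `‖x‖²`: for every vector `x ≠ 0`, the relative deviation is at
least `η` with probability at most `4 e^{-cM}`. -/
def Concentrates (μ : Measure Ω) (A : Ω → Matrix (Fin M) (Fin N) ℝ) (η c : ℝ) : Prop :=
  ∀ x : EuclideanSpace ℂ (Fin N), x ≠ 0 →
    μ {ω | η * ‖x‖ ^ 2 ≤ |‖mulE (toComplex (A ω)) x‖ ^ 2 - ‖x‖ ^ 2|} ≤
      ENNReal.ofReal (4 * Real.exp (-(c * M)))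

end Random

/-! ### Block sparsity and block-based CoSaMP -/

section Algorithm

variable {J k : ℕ} {m n : Type*} [Fintype m] [Fintype n]

/-- A coefficient vector, made of `J` blocks of length `k`, vanishes outside the blocks in `I`. -/
def SupportedOnBlocks (I : Finset (Fin J)) (α : EuclideanSpace ℂ (Fin J × Fin k)) : Prop :=
  ∀ p : Fin J × Fin k, p.1 ∉ I → α p = 0

/-- `α` is `K`-block-sparse. -/
def IsBlockSparse (K : ℕ) (α : EuclideanSpace ℂ (Fin J × Fin k)) : Prop :=
  ∃ I : Finset (Fin J), I.card = K ∧ SupportedOnBlocks I α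

/-- The range of the submatrix `Ψ_I` formed by the blocks of columns in `I`. -/
def blockRange (Ψ : Matrix n (Fin J × Fin k) ℂ) (I : Finset (Fin J)) :
    Set (EuclideanSpace ℂ n) :=
  {z | ∃ α : EuclideanSpace ℂ (Fin J × Fin k), SupportedOnBlocks I α ∧ z = mulE Ψ α}

/-- `I` is a value of `S_Ψ(x, K)`: among the sets of at most `K` blocks it is one whose columns
approximate `x` best (ties may be broken arbitrarily). -/
def IsBlockSupport (Ψ : Matrix n (Fin J × Fin k) ℂ) (x : EuclideanSpace ℂ n) (K : ℕ)
    (I : Finset (Fin J)) : Prop :=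
  I.card ≤ K ∧ ∀ I' : Finset (Fin J), I'.card ≤ K →
    Metric.infDist x (blockRange Ψ I) ≤ Metric.infDist x (blockRange Ψ I')

/-- `p` is a value of `P_Ψ(x, K)`, the projection of `x` onto the `K`-block-sparse signals. -/
def IsBlockProjection (Ψ : Matrix n (Fin J × Fin k) ℂ) (x : EuclideanSpace ℂ n) (K : ℕ)
    (p : EuclideanSpace ℂ n) : Prop :=
  ∃ I : Finset (Fin J), IsBlockSupport Ψ x K I ∧ p ∈ blockRange Ψ I ∧
    ∀ z ∈ blockRange Ψ I, ‖x - p‖ ≤ ‖x - z‖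

/-- The residual `y - A x`. -/
def residual (A : Matrix m n ℂ) (y : EuclideanSpace ℂ m) (x : EuclideanSpace ℂ n) :
    EuclideanSpace ℂ m :=
  y - mulE A x

/-- One pass through the loop of block-based CoSaMP, from the estimate `x` to the estimate `x'`. -/
def BBCoSaMPStep (A : Matrix m n ℂ) (Ψ : Matrix n (Fin J × Fin k) ℂ) (y : EuclideanSpace ℂ m)
    (K : ℕ) (x x' : EuclideanSpace ℂ n) : Prop :=
  ∃ (h p xt : EuclideanSpace ℂ n) (It I₀ : Finset (Fin J)),
    -- proxy
    h = mulE Aᴴ (residual A y x) ∧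
    -- identify
    IsBlockProjection Ψ h (2 * K) p ∧ IsBlockSupport Ψ p (2 * K) It ∧
    -- merge
    IsBlockSupport Ψ x K I₀ ∧
    -- update
    (xt ∈ blockRange Ψ (I₀ ∪ It) ∧
      ∀ z ∈ blockRange Ψ (I₀ ∪ It), ‖y - mulE A xt‖ ≤ ‖y - mulE A z‖) ∧
    IsBlockProjection Ψ xt K x'

/-- `x 0, x 1, …` are the successive estimates of block-based CoSaMP with input `(A, Ψ, y, K)`. -/
def IsBBCoSaMPRun (A : Matrix m n ℂ) (Ψ : Matrix n (Fin J × Fin k) ℂ) (y : EuclideanSpace ℂ m)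
    (K : ℕ) (x : ℕ → EuclideanSpace ℂ n) : Prop :=
  x 0 = 0 ∧ ∀ l, BBCoSaMPStep A Ψ y K (x l) (x (l + 1))

/-- A stopping criterion decides from the iteration counter, the current estimate and the current
residual whether the loop is left. -/
abbrev StoppingCriterion (m n : Type*) : Type _ :=
  ℕ → EuclideanSpace ℂ n → EuclideanSpace ℂ m → Prop

/-- `xhat` is an output of `BBCoSaMP(A, Ψ, y, K)`: the estimate at the first time at which the
stopping criterion is met. -/
def IsBBCoSaMPOutput (crit : StoppingCriterion m n) (A : Matrix m n ℂ)
    (Ψ : Matrix n (Fin J × Fin k) ℂ) (y : EuclideanSpace ℂ m) (K : ℕ)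
    (xhat : EuclideanSpace ℂ n) : Prop :=
  ∃ x : ℕ → EuclideanSpace ℂ n, IsBBCoSaMPRun A Ψ y K x ∧
    ∃ l : ℕ, crit l (x l) (residual A y (x l)) ∧
      (∀ i < l, ¬ crit i (x i) (residual A y (x i))) ∧ xhat = x l

/-- A stopping criterion is adequate, with constants `τ` and `θ`, for signals of norm `S` observed
with noise of norm `ν`: from some iteration on it is met whenever the residual has norm at most
`τ ν`, and it is met only if the residual has norm at most `θ ν` or at least
`log₂ (S / (θ ν))` iterations have been carried out. -/
structure StoppingCriterion.IsAdequate (crit : StoppingCriterion m n) (S ν τ θ : ℝ) : Prop where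
  halts : ∃ L : ℕ, ∀ l, L ≤ l → ∀ x r, ‖r‖ ≤ τ * ν → crit l x r
  accurate : ∀ l x r, crit l x r → ‖r‖ ≤ θ * ν ∨ S ≤ θ * 2 ^ l * ν

end Algorithm

end DPSSRecovery

end

open DPSSRecovery

/-! The three assertions have largely independent proofs, and the third uses the first two only
through their conclusions.

Eigenvalues. The Toeplitz matrix of the band has the energy in `[-W, W]` as its quadratic form, so
by the maximum principle `1 - lam l` is at most the fraction of energy outside the band of any
nonzero test vector orthogonal to the first `l` eigenvectors. A good test vector is a short vector
multiplied, on the polynomial side, by `(1 + z)^r`. This filter has modulus decreasing in `|f|`, so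
it damps the outside of `[-W, W]` exponentially in `r` relative to a narrower band `[-W', W']`. The
trace formula for a smaller Toeplitz matrix leaves enough dimensions to have both some energy in the
narrower band and the required orthogonality (`exists_concentrated`, `IsDPSS.one_sub_lam_le`).
Taking `r` proportional to `N` gives the exponential rate.

Concentration. A normalized row product `∑ a n * X n` is again subgaussian with variance one.
Averaging over an auxiliary Gaussian bounds the exponential moment of its square, a second-order
Taylor bound controls the centred square, and Chernoff over the independent rows finishes
(`lintegral_exp_sq_le`, `measureReal_sum_sq_ge_le`). A complex vector is split into real and
imaginary parts, which doubles the constant 2 to 4.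

Recovery. Let `γ = √C₁ e^{-C₂N/2}`. Each block of the dictionary synthesizes signals with all but a
fraction `γ²` of their energy in its own band; the bands are disjoint, so different blocks are
nearly orthogonal, with an error controlled by `γ`. Summed over pairs this makes the whole
dictionary an isometry up to `2Nγ` (`IsDPSS.abs_norm_sq_dpssDictionary_sub_le`). A union bound over
nets of the coefficient balls, over all choices of at most `4K` blocks, transfers concentration of
`A` to a block-RIP of constant `1/10` for `AΨ` (`Concentrates.exists_event_blockRIP`, with the count
in `count_lt`). On that event everything is deterministic. The proxy identifies the blocks holding
most of the error, least squares loses little beyond what those blocks miss, and pruning at most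
doubles the error; hence one pass halves the error up to a multiple of `‖e‖` (`BlockRIP.step`,
`BlockRIP.run_error`). Termination and accuracy follow by comparing error and residual through the
RIP. -/

noncomputable section

namespace DPSSRecovery

open Complex ComplexConjugate

/-! ### Trigonometric sums and band energies -/

/-- The discrete-time Fourier transform of a vector indexed by `Fin N`. -/
def trigSum {N : ℕ} (x : Fin N → ℂ) (f : ℝ) : ℂ :=
  ∑ n : Fin N, x n * exp (-(2 * Real.pi * f * (n : ℕ) * I))

/-- The Toeplitz matrix of the band-limiting operator, compressed to `{0, …, N-1}`. -/
def bandMatrix (N : ℕ) (W : ℝ) : Matrix (Fin N) (Fin N) ℂ :=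
  Matrix.of fun m n => ∫ f in (-W)..W, exp (2 * Real.pi * f * ((m : ℕ) - (n : ℕ) : ℂ) * I)

@[fun_prop]
lemma continuous_trigSum {N : ℕ} (x : Fin N → ℂ) : Continuous (trigSum x) := by
  unfold trigSum; fun_prop

lemma conj_exp_neg_mul_I (f : ℝ) (n : ℕ) :
    conj (exp (-(2 * Real.pi * f * n * I))) = exp (2 * Real.pi * f * n * I) := by
  rw [← exp_conj]; simp [Complex.conj_ofNat]

lemma trigSum_mul_conj {N N' : ℕ} (x : Fin N → ℂ) (y : Fin N' → ℂ) (f : ℝ) :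
    trigSum x f * conj (trigSum y f) =
      ∑ m : Fin N', ∑ n : Fin N, conj (y m) *
        (exp (2 * Real.pi * f * ((m : ℕ) - (n : ℕ) : ℂ) * I) * x n) := by
  unfold trigSum
  rw [map_sum, Finset.mul_sum]
  refine Finset.sum_congr rfl fun m _ => ?_
  rw [Finset.sum_mul]
  refine Finset.sum_congr rfl fun n _ => ?_
  rw [map_mul, conj_exp_neg_mul_I, mul_sub, sub_mul, sub_eq_neg_add, exp_add]
  ring

/-- The bridge between linear algebra and Fourier analysis: after it, spectral statements about the
Toeplitz matrix become statements about energy in a band. -/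
lemma dotProduct_bandMatrix_mulVec {N : ℕ} (W : ℝ) (x y : Fin N → ℂ) :
    star y ⬝ᵥ bandMatrix N W *ᵥ x = ∫ f in (-W)..W, trigSum x f * conj (trigSum y f) := by
  simp_rw [trigSum_mul_conj]
  rw [intervalIntegral.integral_finsetSum
    (fun m _ => Continuous.intervalIntegrable (by fun_prop) _ _)]
  simp only [dotProduct, Matrix.mulVec, Finset.mul_sum]
  refine Finset.sum_congr rfl fun m _ => ?_
  rw [intervalIntegral.integral_finsetSum
    (fun m _ => Continuous.intervalIntegrable (by fun_prop) _ _)]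
  refine Finset.sum_congr rfl fun n _ => ?_
  rw [intervalIntegral.integral_const_mul, intervalIntegral.integral_mul_const]
  simp [bandMatrix]

lemma bandMatrix_apply_self {N : ℕ} (W : ℝ) (n : Fin N) : bandMatrix N W n n = 2 * W := by
  simp [bandMatrix]; ring

/-- The band of half-width `1/2` is a full period, on which the exponentials are orthonormal. This
gives Parseval (`bandEnergy_half`). -/
lemma bandMatrix_half (N : ℕ) : bandMatrix N (1 / 2) = 1 := by
  ext m n
  rcases eq_or_ne m n with rfl | h
  · rw [bandMatrix_apply_self]; simp
  · rw [Matrix.one_apply_ne h]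
    have hmn : ((m : ℕ) - (n : ℕ) : ℂ) ≠ 0 := by
      rw [sub_ne_zero]; exact_mod_cast fun h' => h (Fin.ext h')
    have hc : (2 * Real.pi * ((m : ℕ) - (n : ℕ) : ℂ) * I) ≠ 0 := by
      simp [hmn, Real.pi_ne_zero]
    have := integral_exp_mul_complex (a := -(1 / 2)) (b := 1 / 2) hc
    simp only [bandMatrix, Matrix.of_apply]
    have e : ∀ f : ℝ, exp (2 * Real.pi * f * ((m : ℕ) - (n : ℕ) : ℂ) * I) =
        exp (2 * Real.pi * ((m : ℕ) - (n : ℕ) : ℂ) * I * f) := fun f => by ring_nf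
    simp_rw [e]
    rw [this]
    have h1 : exp (2 * Real.pi * ((m : ℕ) - (n : ℕ) : ℂ) * I * ((1 / 2 : ℝ) : ℂ)) =
        exp (2 * Real.pi * ((m : ℕ) - (n : ℕ) : ℂ) * I * ((-(1 / 2) : ℝ) : ℂ)) := by
      rw [exp_eq_exp_iff_exists_int]
      exact ⟨(m : ℕ) - (n : ℕ), by push_cast; ring⟩
    rw [h1, sub_self, zero_div]

lemma integral_trigSum_mul_conj {N : ℕ} (x y : Fin N → ℂ) :
    ∫ f in (-(1 / 2) : ℝ)..(1 / 2), trigSum x f * conj (trigSum y f) = star y ⬝ᵥ x := by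
  rw [← dotProduct_bandMatrix_mulVec, bandMatrix_half, Matrix.one_mulVec]

lemma isHermitian_bandMatrix (N : ℕ) (W : ℝ) : (bandMatrix N W).IsHermitian := by
  ext m n
  simp only [Matrix.conjTranspose_apply, bandMatrix, Matrix.of_apply]
  rw [RCLike.star_def, intervalIntegral, intervalIntegral, map_sub, ← integral_conj,
    ← integral_conj]
  have e : ∀ f : ℝ, conj (exp (2 * Real.pi * f * ((n : ℕ) - (m : ℕ) : ℂ) * I)) =
      exp (2 * Real.pi * f * ((m : ℕ) - (n : ℕ) : ℂ) * I) := fun f => by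
    rw [← exp_conj]
    simp only [map_mul, map_sub, conj_I, conj_ofReal, Complex.conj_ofNat, conj_natCast]
    ring_nf
  simp_rw [e]

/-- The energy of the transform of `x` in the band `[a, b]`. -/
def bandEnergy {N : ℕ} (a b : ℝ) (x : Fin N → ℂ) : ℝ := ∫ f in a..b, ‖trigSum x f‖ ^ 2

lemma ofReal_bandEnergy {N : ℕ} (W : ℝ) (x : Fin N → ℂ) :
    ((bandEnergy (-W) W x : ℝ) : ℂ) = star x ⬝ᵥ bandMatrix N W *ᵥ x := by
  rw [dotProduct_bandMatrix_mulVec, bandEnergy, ← intervalIntegral.integral_ofReal]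
  simp_rw [Complex.mul_conj']
  norm_cast

lemma intervalIntegrable_sq_norm_trigSum {N : ℕ} (x : Fin N → ℂ) (a b : ℝ) :
    IntervalIntegrable (fun f => ‖trigSum x f‖ ^ 2) volume a b :=
  Continuous.intervalIntegrable (by fun_prop) _ _

lemma bandEnergy_half {N : ℕ} (x : EuclideanSpace ℂ (Fin N)) :
    bandEnergy (-(1 / 2)) (1 / 2) x.ofLp = ‖x‖ ^ 2 := by
  have h := ofReal_bandEnergy (1 / 2) x.ofLp
  rw [bandMatrix_half, Matrix.one_mulVec, dotProduct_comm, ← EuclideanSpace.inner_eq_star_dotProduct,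
    inner_self_eq_norm_sq_to_K] at h
  exact Complex.ofReal_injective (by rw [h]; simp)

lemma bandEnergy_add {N : ℕ} (a b c : ℝ) (x : Fin N → ℂ) :
    bandEnergy a b x + bandEnergy b c x = bandEnergy a c x :=
  intervalIntegral.integral_add_adjacent_intervals
    (intervalIntegrable_sq_norm_trigSum _ _ _) (intervalIntegrable_sq_norm_trigSum _ _ _)

lemma bandEnergy_nonneg {N : ℕ} {a b : ℝ} (hab : a ≤ b) (x : Fin N → ℂ) :
    0 ≤ bandEnergy a b x :=
  intervalIntegral.integral_nonneg hab fun _ _ => by positivity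

lemma bandEnergy_mono {N : ℕ} {a b c d : ℝ} (h₁ : a ≤ b) (h₃ : c ≤ d)
    (x : Fin N → ℂ) : bandEnergy b c x ≤ bandEnergy a d x := by
  rw [← bandEnergy_add a b d, ← bandEnergy_add b c d]
  linarith [bandEnergy_nonneg h₁ x, bandEnergy_nonneg h₃ x]

/-- The energy in the band, expanded in an orthonormal basis of eigenvectors. -/
lemma bandEnergy_eq_sum {N : ℕ} {ι : Type*} [Fintype ι] (W : ℝ)
    (b : OrthonormalBasis ι ℂ (EuclideanSpace ℂ (Fin N))) (lam : ι → ℝ)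
    (h : ∀ i, bandMatrix N W *ᵥ (b i).ofLp = (lam i : ℂ) • (b i).ofLp)
    (x : EuclideanSpace ℂ (Fin N)) :
    bandEnergy (-W) W x.ofLp = ∑ i, lam i * ‖inner ℂ (b i) x‖ ^ 2 := by
  have key : ((bandEnergy (-W) W x.ofLp : ℝ) : ℂ) =
      inner ℂ x (WithLp.toLp 2 (bandMatrix N W *ᵥ x.ofLp)) := by
    rw [ofReal_bandEnergy, EuclideanSpace.inner_eq_star_dotProduct, dotProduct_comm]
  have hb : ∀ i, inner ℂ (b i) (WithLp.toLp 2 (bandMatrix N W *ᵥ x.ofLp)) =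
      (lam i : ℂ) * inner ℂ (b i) x := fun i => by
    rw [EuclideanSpace.inner_eq_star_dotProduct, EuclideanSpace.inner_eq_star_dotProduct,
      dotProduct_comm, Matrix.dotProduct_mulVec, ← (isHermitian_bandMatrix N W).eq,
      ← Matrix.star_mulVec, h i, dotProduct_comm]
    simp [dotProduct_smul]
  rw [← b.sum_inner_mul_inner] at key
  simp_rw [hb] at key
  have : ∀ i, inner ℂ x (b i) * ((lam i : ℂ) * inner ℂ (b i) x) =
      ((lam i * ‖inner ℂ (b i) x‖ ^ 2 : ℝ) : ℂ) := fun i => by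
    rw [← inner_conj_symm x (b i), mul_left_comm, Complex.conj_mul']
    push_cast; rfl
  simp_rw [this] at key
  exact_mod_cast key

/-! ### Properties of the discrete prolate spheroidal sequences -/

lemma dtft_timeLimit (N : ℕ) (x : ℤ → ℂ) (f : ℝ) :
    dtft (timeLimit N x) f = trigSum (fun n : Fin N => x ((n : ℕ) : ℤ)) f := by
  have hinj : Function.Injective (fun n : Fin N => ((n : ℕ) : ℤ)) := fun a b h => by
    simpa [Fin.ext_iff] using h
  unfold dtft trigSum
  rw [tsum_eq_sum (s := Finset.univ.map ⟨_, hinj⟩), Finset.sum_map]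
  · refine Finset.sum_congr rfl fun n _ => ?_
    simp [timeLimit]
  · intro n hn
    have : ¬ (0 ≤ n ∧ n < (N : ℤ)) := fun ⟨h0, h1⟩ => hn (by
      simp only [Finset.mem_map, Finset.mem_univ, true_and, Function.Embedding.coeFn_mk]
      exact ⟨⟨n.toNat, by omega⟩, by simp [h0]⟩)
    simp [timeLimit, this]

section DPSS

variable {N : ℕ} {W : ℝ} {lam : Fin N → ℝ} {s : Fin N → ℤ → ℝ}

/-- The eigenvalue equation on all of `ℤ`, read only at the indices `0, …, N-1`. -/
lemma IsDPSS.bandMatrix_mulVec (hs : IsDPSS N W lam s) (l : Fin N) :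
    bandMatrix N W *ᵥ (fun n : Fin N => (s l ((n : ℕ) : ℤ) : ℂ)) =
      (lam l : ℂ) • fun n : Fin N => (s l ((n : ℕ) : ℤ) : ℂ) := by
  ext m
  have h := hs.eigen l ((m : ℕ) : ℤ)
  rw [bandLimit] at h
  simp_rw [dtft_timeLimit] at h
  simp only [Pi.smul_apply, smul_eq_mul]
  rw [← h]
  simp only [Matrix.mulVec, dotProduct, bandMatrix, Matrix.of_apply, trigSum, Finset.sum_mul]
  rw [intervalIntegral.integral_finsetSum
    (fun m _ => Continuous.intervalIntegrable (by fun_prop) _ _)]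
  refine Finset.sum_congr rfl fun n _ => ?_
  rw [← intervalIntegral.integral_mul_const]
  congr 1; ext f
  rw [mul_assoc _ (exp _) (exp _), ← exp_add, mul_comm]
  congr 2
  push_cast; ring

lemma IsDPSS.exists_orthonormalBasis (hs : IsDPSS N W lam s) :
    ∃ b : OrthonormalBasis (Fin N) ℂ (EuclideanSpace ℂ (Fin N)),
      ∀ l, (b l).ofLp = fun n : Fin N => (s l ((n : ℕ) : ℤ) : ℂ) := by
  let v : Fin N → EuclideanSpace ℂ (Fin N) :=
    fun l => WithLp.toLp 2 fun n : Fin N => (s l ((n : ℕ) : ℤ) : ℂ)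
  have hv : Orthonormal ℂ v := by
    rw [orthonormal_iff_ite]
    intro l l'
    have : inner ℂ (v l) (v l') =
        ((∑ n : Fin N, s l ((n : ℕ) : ℤ) * s l' ((n : ℕ) : ℤ) : ℝ) : ℂ) := by
      rw [EuclideanSpace.inner_eq_star_dotProduct]
      simp [v, dotProduct, mul_comm]
    rw [this]
    split_ifs with h
    · subst h
      have := hs.normalized l
      simp only [pow_two] at this
      rw [this]; simp
    · rw [hs.orthogonal l l' h]; simp
  have hspan : ⊤ ≤ Submodule.span ℂ (Set.range v) :=
    (hv.linearIndependent.span_eq_top_of_card_eq_finrank' (by simp)).ge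
  exact ⟨OrthonormalBasis.mk hv hspan, fun l => by rw [OrthonormalBasis.coe_mk]⟩

lemma bandEnergy_le_norm_sq {W : ℝ} (h : W ≤ 1 / 2)
    (x : EuclideanSpace ℂ (Fin N)) : bandEnergy (-W) W x.ofLp ≤ ‖x‖ ^ 2 := by
  rw [← bandEnergy_half]
  exact bandEnergy_mono (by linarith) h _

/-- The maximum principle for the eigenvalues, applied to one vector. -/
lemma IsDPSS.bandEnergy_le (hs : IsDPSS N W lam s) (l : Fin N) (x : EuclideanSpace ℂ (Fin N))
    (hx : ∀ i : Fin N, i < l → ∑ n : Fin N, (s i ((n : ℕ) : ℤ) : ℂ) * x n = 0) :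
    bandEnergy (-W) W x.ofLp ≤ lam l * ‖x‖ ^ 2 := by
  obtain ⟨b, hb⟩ := hs.exists_orthonormalBasis
  rw [bandEnergy_eq_sum W b lam (fun i => by rw [hb i, hs.bandMatrix_mulVec]),
    ← b.sum_sq_norm_inner_right, Finset.mul_sum]
  refine Finset.sum_le_sum fun i _ => ?_
  rcases lt_or_ge i l with h | h
  · have : inner ℂ (b i) x = 0 := by
      rw [EuclideanSpace.inner_eq_star_dotProduct, hb, ← hx i h]
      simp [dotProduct, mul_comm]
    simp [this]
  · exact mul_le_mul_of_nonneg_right (hs.antitone h) (by positivity)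

end DPSS

/-! ### Clustering of the eigenvalues near one -/

/-- The polynomial with coefficients `y`. -/
def coeffPoly {n : ℕ} (y : Fin n → ℂ) : Polynomial ℂ :=
  ∑ j : Fin n, Polynomial.monomial (j : ℕ) (y j)

/-- Convolution with the binomial coefficients of `(1 + z)^r`. -/
def binomialFilter (n r N : ℕ) : (Fin n → ℂ) →ₗ[ℂ] (Fin N → ℂ) where
  toFun y m := ((1 + Polynomial.X) ^ r * coeffPoly y).coeff m
  map_add' x y := by
    ext m
    simp [coeffPoly, Finset.sum_add_distrib, mul_add]
  map_smul' c y := by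
    ext m
    have : coeffPoly (c • y) = Polynomial.C c * coeffPoly y := by
      simp [coeffPoly, Finset.mul_sum, Polynomial.C_mul_monomial]
    rw [this, mul_left_comm, Polynomial.coeff_C_mul]
    simp

lemma trigSum_eq_eval {n : ℕ} (y : Fin n → ℂ) (f : ℝ) :
    trigSum y f = (coeffPoly y).eval (exp (-(2 * Real.pi * f * I))) := by
  rw [trigSum, coeffPoly, Polynomial.eval_finsetSum]
  refine Finset.sum_congr rfl fun j _ => ?_
  rw [Polynomial.eval_monomial, ← exp_nat_mul]
  congr 2; ring

/-- Multiplication of polynomials is multiplication of transforms; the degree is below `N`, so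
reading off only `N` coefficients truncates nothing. -/
lemma trigSum_binomialFilter {n r N : ℕ} (hN : 0 < N) (h : n + r ≤ N) (y : Fin n → ℂ) (f : ℝ) :
    trigSum (binomialFilter n r N y) f =
      (1 + exp (-(2 * Real.pi * f * I))) ^ r * trigSum y f := by
  have hdeg : ((1 + Polynomial.X) ^ r * coeffPoly y).natDegree < N := by
    have h1 : ((1 + Polynomial.X : Polynomial ℂ) ^ r).natDegree ≤ r := by
      refine (Polynomial.natDegree_pow_le).trans ?_
      have : (1 + Polynomial.X : Polynomial ℂ).natDegree ≤ 1 := by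
        rw [add_comm]; exact (Polynomial.natDegree_X_add_C (1 : ℂ)).le
      nlinarith
    have h2 : (coeffPoly y).natDegree ≤ n - 1 :=
      Polynomial.natDegree_sum_le_of_forall_le _ _ fun j _ =>
        (Polynomial.natDegree_monomial_le _).trans (by omega)
    rcases Nat.eq_zero_or_pos n with rfl | hn
    · simpa [coeffPoly] using hN
    · exact (Polynomial.natDegree_mul_le.trans (Nat.add_le_add h1 h2)).trans_lt (by omega)
  have hev := Polynomial.eval_eq_sum_range' hdeg (exp (-(2 * Real.pi * f * I)))
  rw [Polynomial.eval_mul, ← trigSum_eq_eval, Polynomial.eval_pow, Polynomial.eval_add,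
    Polynomial.eval_one, Polynomial.eval_X, Finset.sum_range] at hev
  rw [hev]
  refine Finset.sum_congr rfl fun j _ => ?_
  rw [← exp_nat_mul]
  simp only [binomialFilter, LinearMap.coe_mk, AddHom.coe_mk]
  congr 2; ring

/-- The squared modulus of the transfer function `1 + e^{-j2πf}`. -/
def gainSq (f : ℝ) : ℝ := 2 + 2 * Real.cos (2 * Real.pi * f)

lemma norm_sq_one_add_exp (f : ℝ) : ‖1 + exp (-(2 * Real.pi * f * I))‖ ^ 2 = gainSq f := by
  have : (-(2 * Real.pi * f * I) : ℂ) = ((-(2 * Real.pi * f) : ℝ) : ℂ) * I := by push_cast; ring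
  rw [this, ← Complex.normSq_eq_norm_sq, Complex.normSq_apply]
  simp only [add_re, one_re, add_im, one_im, exp_ofReal_mul_I_re, exp_ofReal_mul_I_im,
    Real.cos_neg, Real.sin_neg, gainSq]
  nlinarith [Real.sin_sq_add_cos_sq (2 * Real.pi * f)]

lemma gainSq_nonneg (f : ℝ) : 0 ≤ gainSq f := by
  rw [← norm_sq_one_add_exp]; positivity

lemma gainSq_neg (f : ℝ) : gainSq (-f) = gainSq f := by simp [gainSq]

lemma gainSq_lt {a b : ℝ} (ha : 0 ≤ a) (hab : a < b) (hb : b ≤ 1 / 2) :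
    gainSq b < gainSq a := by
  have := Real.cos_lt_cos_of_nonneg_of_le_pi (x := 2 * Real.pi * a) (y := 2 * Real.pi * b)
    (by positivity) (by nlinarith [Real.pi_pos]) (by nlinarith [Real.pi_pos])
  unfold gainSq; linarith

lemma gainSq_pos {a : ℝ} (ha : 0 ≤ a) (h : a < 1 / 2) : 0 < gainSq a :=
  (gainSq_nonneg _).trans_lt (gainSq_lt ha h le_rfl)

lemma gainSq_le {a b : ℝ} (ha : 0 ≤ a) (hab : a ≤ |b|) (hb : |b| ≤ 1 / 2) :
    gainSq b ≤ gainSq a := by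
  have e : gainSq b = gainSq |b| := by
    rcases abs_choice b with h | h <;> rw [h]
    rw [gainSq_neg]
  rw [e]
  rcases hab.eq_or_lt with h | h
  · rw [h]
  · exact (gainSq_lt ha h hb).le

/-! ### Filtered test vectors and the eigenvalue estimate -/

section

variable {n r N : ℕ}

lemma norm_sq_trigSum_binomialFilter (hN : 0 < N) (h : n + r ≤ N) (y : Fin n → ℂ) (f : ℝ) :
    ‖trigSum (binomialFilter n r N y) f‖ ^ 2 = gainSq f ^ r * ‖trigSum y f‖ ^ 2 := by
  rw [trigSum_binomialFilter hN h, norm_mul, mul_pow, norm_pow, ← pow_mul, mul_comm r, pow_mul,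
    norm_sq_one_add_exp]

lemma bandEnergy_binomialFilter_le (hN : 0 < N) (h : n + r ≤ N) (y : Fin n → ℂ) {a b g : ℝ}
    (hab : a ≤ b) (hg : ∀ f ∈ Set.Icc a b, gainSq f ≤ g) :
    bandEnergy a b (binomialFilter n r N y) ≤ g ^ r * bandEnergy a b y := by
  unfold bandEnergy
  rw [← intervalIntegral.integral_const_mul]
  refine intervalIntegral.integral_mono_on hab (intervalIntegrable_sq_norm_trigSum _ _ _)
    ((intervalIntegrable_sq_norm_trigSum _ _ _).const_mul _) fun f hf => ?_
  rw [norm_sq_trigSum_binomialFilter hN h]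
  exact mul_le_mul_of_nonneg_right (pow_le_pow_left₀ (gainSq_nonneg f) (hg f hf) r) (by positivity)

lemma le_bandEnergy_binomialFilter (hN : 0 < N) (h : n + r ≤ N) (y : Fin n → ℂ) {a b g : ℝ}
    (hab : a ≤ b) (h0 : 0 ≤ g) (hg : ∀ f ∈ Set.Icc a b, g ≤ gainSq f) :
    g ^ r * bandEnergy a b y ≤ bandEnergy a b (binomialFilter n r N y) := by
  unfold bandEnergy
  rw [← intervalIntegral.integral_const_mul]
  refine intervalIntegral.integral_mono_on hab
    ((intervalIntegrable_sq_norm_trigSum _ _ _).const_mul _)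
    (intervalIntegrable_sq_norm_trigSum _ _ _) fun f hf => ?_
  rw [norm_sq_trigSum_binomialFilter hN h]
  exact mul_le_mul_of_nonneg_right (pow_le_pow_left₀ h0 (hg f hf) r) (by positivity)

/-- By the trace formula many eigenvalues of the band-limiting matrix exceed a given level. -/
lemma card_eigenvalues_ge {W c : ℝ} (hW : W ≤ 1 / 2) (hc : 0 < c) :
    n * (2 * W - c) ≤
      (Fintype.card {j : Fin n // c ≤ (isHermitian_bandMatrix n W).eigenvalues j} : ℝ) := by
  set hG := isHermitian_bandMatrix n W
  have htr : ∑ i, hG.eigenvalues i = 2 * W * n := by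
    have := hG.trace_eq_sum_eigenvalues
    simp only [Matrix.trace, Matrix.diag_apply, bandMatrix_apply_self, Finset.sum_const,
      Finset.card_univ, Fintype.card_fin, nsmul_eq_mul] at this
    have h2 : ((∑ i, hG.eigenvalues i : ℝ) : ℂ) = ((2 * W * n : ℝ) : ℂ) := by
      push_cast
      rw [mul_comm, this]; rfl
    exact_mod_cast h2
  have hle : ∀ j, hG.eigenvalues j ≤ 1 := fun j => by
    have h1 := bandEnergy_le_norm_sq hW (hG.eigenvectorBasis j)
    have h2 := bandEnergy_eq_sum W hG.eigenvectorBasis hG.eigenvalues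
      (fun i => by rw [hG.mulVec_eigenvectorBasis]; ext; simp) (hG.eigenvectorBasis j)
    rw [h2, hG.eigenvectorBasis.orthonormal.1 j, Finset.sum_eq_single j] at h1
    · simpa [hG.eigenvectorBasis.orthonormal.1 j] using h1
    · intro i _ hij
      simp [hG.eigenvectorBasis.orthonormal.2 hij]
    · simp
  -- An eigenvalue is at most 1 if it reaches the level `c`, and below `c` otherwise.
  have hb : ∑ i, hG.eigenvalues i ≤ ∑ i : Fin n, ((if c ≤ hG.eigenvalues i then 1 else 0) + c) :=
    Finset.sum_le_sum fun i _ => by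
      split_ifs with h
      · linarith [hle i]
      · linarith
  rw [Finset.sum_add_distrib, Finset.sum_boole, htr] at hb
  rw [Fintype.card_subtype]
  simp at hb
  linarith

variable {W : ℝ} {lam : Fin N → ℝ} {s : Fin N → ℤ → ℝ}

/-- A nonzero vector, concentrated in the band and orthogonal after filtering to the first `l`
prolate sequences. -/
lemma exists_concentrated {c W' : ℝ} (s : Fin N → ℤ → ℝ) (h1 : W' ≤ 1 / 2)
    (hc : 0 < c) (l : Fin N) (hl : ((l : ℕ) : ℝ) < n * (2 * W' - c)) :
    ∃ y : EuclideanSpace ℂ (Fin n), y ≠ 0 ∧ c * ‖y‖ ^ 2 ≤ bandEnergy (-W') W' y.ofLp ∧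
      ∀ i : Fin N, i < l →
        ∑ m : Fin N, (s i ((m : ℕ) : ℤ) : ℂ) * binomialFilter n r N y.ofLp m = 0 := by
  classical
  set hG := isHermitian_bandMatrix n W'
  have hcard := (hl.trans_le (card_eigenvalues_ge (n := n) h1 hc))
  have hcard : (l : ℕ) < Fintype.card {j : Fin n // c ≤ hG.eigenvalues j} := by exact_mod_cast hcard
  let F₁ : EuclideanSpace ℂ (Fin n) →ₗ[ℂ] (Fin (l : ℕ) → ℂ) :=
    LinearMap.pi fun i => (Fintype.linearCombination ℂ
      (fun m : Fin N => (s (Fin.castLE l.2.le i) ((m : ℕ) : ℤ) : ℂ))) ∘ₗ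
        (binomialFilter n r N) ∘ₗ (WithLp.linearEquiv 2 ℂ (Fin n → ℂ)).toLinearMap
  let F₂ : EuclideanSpace ℂ (Fin n) →ₗ[ℂ] ({j : Fin n // ¬ c ≤ hG.eigenvalues j} → ℂ) :=
    LinearMap.pi fun j => (innerSL ℂ (hG.eigenvectorBasis j)).toLinearMap
  -- Dimension count: `l` orthogonality conditions and one condition for each eigenvalue below `c`
  -- are together fewer than `n`.
  have hker : LinearMap.ker (F₁.prod F₂) ≠ ⊥ := by
    apply LinearMap.ker_ne_bot_of_finrank_lt
    rw [Module.finrank_prod, Module.finrank_fintype_fun_eq_card,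
      Module.finrank_fintype_fun_eq_card, finrank_euclideanSpace, Fintype.card_fin,
      Fintype.card_fin, Fintype.card_subtype_compl, Fintype.card_fin]
    have := Fintype.card_subtype_le (fun j : Fin n => c ≤ hG.eigenvalues j)
    rw [Fintype.card_fin] at this
    omega
  obtain ⟨y, hy, hy0⟩ := Submodule.exists_mem_ne_zero_of_ne_bot hker
  rw [LinearMap.mem_ker] at hy
  have hy₁ : F₁ y = 0 := congrArg Prod.fst hy
  have hy₂ : F₂ y = 0 := congrArg Prod.snd hy
  refine ⟨y, hy0, ?_, ?_⟩
  · rw [bandEnergy_eq_sum W' hG.eigenvectorBasis hG.eigenvalues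
      (fun i => by rw [hG.mulVec_eigenvectorBasis]; ext; simp),
      ← hG.eigenvectorBasis.sum_sq_norm_inner_right, Finset.mul_sum]
    refine Finset.sum_le_sum fun j _ => ?_
    by_cases hj : c ≤ hG.eigenvalues j
    · exact mul_le_mul_of_nonneg_right hj (by positivity)
    · have := congrFun hy₂ ⟨j, hj⟩
      have h' : inner ℂ (hG.eigenvectorBasis j) y = 0 := this
      simp [h']
  · intro i hi
    have := congrFun hy₁ ⟨i, hi⟩
    simp only [F₁, LinearMap.pi_apply, LinearMap.comp_apply, Fintype.linearCombination_apply,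
      Pi.zero_apply, smul_eq_mul] at this
    rw [← this]
    exact Finset.sum_congr rfl fun m _ => mul_comm _ _

/-- Test the maximum principle with the filtered vector `x` of a concentrated `y`. Outside `[-W, W]`
the filter multiplies energy by at most `gainSq W ^ r`, inside `[-W', W']` by at least `gainSq W' ^
r`, and `y` keeps a fraction `c` of its energy there. -/
lemma IsDPSS.one_sub_lam_le (hs : IsDPSS N W lam s) (h : n + r ≤ N) {W' c : ℝ} (h0 : 0 ≤ W')
    (h1 : W' < W) (hW : W < 1 / 2) (hc : 0 < c) (l : Fin N)
    (hl : ((l : ℕ) : ℝ) < n * (2 * W' - c)) :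
    1 - lam l ≤ (gainSq W / gainSq W') ^ r / c := by
  have hN : 0 < N := l.pos
  obtain ⟨y, hy0, hyc, hyo⟩ := exists_concentrated (r := r) s (by linarith) hc l hl
  set x : EuclideanSpace ℂ (Fin N) := WithLp.toLp 2 (binomialFilter n r N y.ofLp) with hx
  have hmax := hs.bandEnergy_le l x hyo
  have hg : 0 < gainSq W' := gainSq_pos h0 (by linarith)
  have hgW := gainSq_nonneg W
  have hsplit : ‖x‖ ^ 2 = bandEnergy (-(1 / 2)) (-W) x.ofLp + bandEnergy (-W) W x.ofLp +
      bandEnergy W (1 / 2) x.ofLp := by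
    rw [← bandEnergy_half, bandEnergy_add, bandEnergy_add]
  have hsplit' : ‖y‖ ^ 2 = bandEnergy (-(1 / 2)) (-W) y.ofLp + bandEnergy (-W) W y.ofLp +
      bandEnergy W (1 / 2) y.ofLp := by
    rw [← bandEnergy_half, bandEnergy_add, bandEnergy_add]
  have hW0 : 0 < W := h0.trans_lt h1
  have ho1 : bandEnergy (-(1 / 2)) (-W) x.ofLp ≤ gainSq W ^ r * bandEnergy (-(1 / 2)) (-W) y.ofLp :=
    bandEnergy_binomialFilter_le hN h _ (by linarith) fun f hf =>
      gainSq_le hW0.le (by rw [abs_of_nonpos (by linarith [hf.2])]; linarith [hf.2])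
        (by rw [abs_of_nonpos (by linarith [hf.2])]; linarith [hf.1])
  have ho2 : bandEnergy W (1 / 2) x.ofLp ≤ gainSq W ^ r * bandEnergy W (1 / 2) y.ofLp :=
    bandEnergy_binomialFilter_le hN h _ (by linarith) fun f hf =>
      gainSq_le hW0.le (by rw [abs_of_nonneg (by linarith [hf.1])]; linarith [hf.1])
        (by rw [abs_of_nonneg (by linarith [hf.1])]; linarith [hf.2])
  have hin : gainSq W' ^ r * bandEnergy (-W') W' y.ofLp ≤ bandEnergy (-W') W' x.ofLp :=
    le_bandEnergy_binomialFilter hN h _ (by linarith) hg.le fun f hf => by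
      have : |f| ≤ W' := abs_le.2 hf
      have e : gainSq f = gainSq |f| := by
        rcases abs_choice f with h | h <;> rw [h]
        rw [gainSq_neg]
      rw [e]
      exact gainSq_le (abs_nonneg f) (by rwa [abs_of_nonneg h0]) (by rw [abs_of_nonneg h0]; linarith)
  have hx1 : bandEnergy (-W') W' x.ofLp ≤ ‖x‖ ^ 2 := bandEnergy_le_norm_sq (by linarith) x
  have hout : (1 - lam l) * ‖x‖ ^ 2 ≤ gainSq W ^ r * ‖y‖ ^ 2 := by
    have := mul_nonneg (pow_nonneg hgW r) (bandEnergy_nonneg (a := -W) (b := W) (by linarith) y.ofLp)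
    rw [hsplit']
    nlinarith
  have hlow : gainSq W' ^ r * (c * ‖y‖ ^ 2) ≤ ‖x‖ ^ 2 :=
    (mul_le_mul_of_nonneg_left hyc (by positivity)).trans (hin.trans hx1)
  have hynorm : 0 < ‖y‖ ^ 2 := by positivity
  rw [div_pow, div_div, le_div_iff₀ (by positivity)]
  rcases le_or_gt (1 - lam l) 0 with hneg | hpos
  · exact (mul_nonpos_of_nonpos_of_nonneg hneg (by positivity)).trans (by positivity)
  · refine le_of_mul_le_mul_right ?_ hynorm
    calc (1 - lam l) * (gainSq W' ^ r * c) * ‖y‖ ^ 2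
        = (1 - lam l) * (gainSq W' ^ r * (c * ‖y‖ ^ 2)) := by ring
      _ ≤ (1 - lam l) * ‖x‖ ^ 2 := mul_le_mul_of_nonneg_left hlow hpos.le
      _ ≤ _ := hout

end

/-- Narrowing the band, the level `c` and shortening the vector by `r` each cost a fraction of order
`ε` of the admissible indices, less than `ε` in total, while `r ≈ εN/4` makes `q ^ r` exponentially
small. Half of the rate is given up to absorb `1 / (c * q)`, which allows `C₁ = 1`. -/
theorem exists_eigenvaluesNearOne {W ε : ℝ} (hW : 0 < W) (hW' : W < 1 / 2) (hε : 0 < ε)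
    (hε' : ε < 1) : ∃ C₂ : ℝ, 0 < C₂ ∧ ∃ N₀ : ℕ, EigenvaluesNearOne W ε 1 C₂ N₀ := by
  set W' := W * (1 - ε / 4)
  set c := W * ε / 4
  have hc : 0 < c := by positivity
  have h0 : 0 < W' := mul_pos hW (by linarith)
  have h1 : W' < W := by simp only [W']; nlinarith
  set q := gainSq W / gainSq W'
  have hg : 0 < gainSq W := gainSq_pos hW.le hW'
  have hg' : 0 < gainSq W' := gainSq_pos h0.le (by linarith)
  have hq0 : 0 < q := div_pos hg hg'
  have hq1 : q < 1 := (div_lt_one hg').2 (gainSq_lt h0.le h1 hW'.le)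
  have hlog : Real.log q < 0 := Real.log_neg hq0 hq1
  set C₂ := -Real.log q * (ε / 8)
  have hC : 0 < C₂ := mul_pos (by linarith) (by linarith)
  refine ⟨C₂, hC, ⌈1 / (c * q) / C₂⌉₊, ?_⟩
  intro N hN lam s hs l hl
  have hN0 : 0 < N := l.pos
  have hNR : (0 : ℝ) < N := by exact_mod_cast hN0
  set r := ⌊ε / 4 * N⌋₊
  have hr : (r : ℝ) ≤ ε / 4 * N := Nat.floor_le (by positivity)
  have hr' : ε / 4 * N < r + 1 := Nat.lt_floor_add_one _
  have hrN : r ≤ N := by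
    have : (r : ℝ) ≤ N := hr.trans (by nlinarith)
    exact_mod_cast this
  have key := hs.one_sub_lam_le (n := N - r) (r := r) (W' := W') (c := c) (by omega) h0.le h1 hW'
    hc l (by
      rw [Nat.cast_sub hrN]
      refine hl.trans_lt ?_
      have e : 2 * W' - c = 2 * W * (1 - 3 * ε / 8) := by simp only [W', c]; ring
      rw [e]
      have h2 : N * (1 - ε / 4) * (2 * W * (1 - 3 * ε / 8)) ≤
          (N - r : ℝ) * (2 * W * (1 - 3 * ε / 8)) := by
        refine mul_le_mul_of_nonneg_right (by linarith) ?_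
        have : 0 < 1 - 3 * ε / 8 := by linarith
        positivity
      refine lt_of_lt_of_le ?_ h2
      have : 0 < N * W * (ε * (3 / 4 + 3 * ε / 16)) := by positivity
      nlinarith)
  -- The floor only guarantees `r + 1 > εN/4`; the missing factor is the `1 / q`.
  have hpow : q ^ r ≤ Real.exp (-(2 * C₂ * N)) / q := by
    rw [le_div_iff₀ hq0, ← pow_succ, ← Real.exp_log (pow_pos hq0 (r + 1)), Real.log_pow]
    refine Real.exp_le_exp.2 ?_
    simp only [C₂]
    push_cast
    nlinarith
  -- This is what `N₀` was chosen for: `1 / (c * q) ≤ C₂ * N < e^{C₂ N}`.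
  have hbig : 1 / (c * q) ≤ Real.exp (C₂ * N) := by
    have h3 : 1 / (c * q) / C₂ ≤ N := (Nat.le_ceil _).trans (by exact_mod_cast hN)
    rw [div_le_iff₀ hC] at h3
    have := Real.add_one_le_exp (C₂ * N)
    linarith
  have : q ^ r / c ≤ Real.exp (-(C₂ * N)) := by
    calc q ^ r / c ≤ Real.exp (-(2 * C₂ * N)) / q / c := by gcongr
      _ = Real.exp (-(2 * C₂ * N)) * (1 / (c * q)) := by field_simp
      _ ≤ Real.exp (-(2 * C₂ * N)) * Real.exp (C₂ * N) := by gcongr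
      _ = Real.exp (-(C₂ * N)) := by rw [← Real.exp_add]; ring_nf
  linarith

open scoped ENNReal NNReal

/-! ### Concentration for subgaussian matrices -/

section Concentration

variable {Ω : Type*} [MeasurableSpace Ω] {μ : Measure Ω}

/-- Joint independence says that the law is a product measure, and a product over pairs curries to a
product of products. -/
lemma iIndepFun_rows {ι κ : Type*} [Countable ι] [Countable κ] {X : ι × κ → Ω → ℝ}
    (mX : ∀ p, Measurable (X p))
    (h : iIndepFun X μ) : iIndepFun (fun i ω j => X (i, j) ω) μ := by
  have := h.isProbabilityMeasure
  have : ∀ p, IsProbabilityMeasure (μ.map (X p)) :=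
    fun p => Measure.isProbabilityMeasure_map (mX p).aemeasurable
  have e : (fun ω i j => X (i, j) ω) = (MeasurableEquiv.curry ι κ ℝ) ∘ fun ω p => X p ω := rfl
  rw [iIndepFun_iff_map_fun_eq_infinitePi_map (by fun_prop), e,
    ← Measure.map_map (by fun_prop) (by fun_prop),
    (iIndepFun_iff_map_fun_eq_infinitePi_map mX).1 h,
    Measure.infinitePi_map_curry (fun i j => μ.map (X (i, j)))]
  congrm Measure.infinitePi fun i => ?_
  exact ((iIndepFun_iff_map_fun_eq_infinitePi_map (by fun_prop)).1
    (h.precomp (Prod.mk_right_injective i))).symm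

/-- The factor `e^{g²/4}` turns the density of variance 1 into `√2` times the density of variance 2.
-/
lemma lintegral_exp_sq_gaussianReal :
    ∫⁻ g, ENNReal.ofReal (Real.exp (g ^ 2 / 4)) ∂(gaussianReal 0 1) = ENNReal.ofReal √2 := by
  have hpt : ∀ g : ℝ, gaussianPDF 0 1 g * ENNReal.ofReal (Real.exp (g ^ 2 / 4)) =
      ENNReal.ofReal √2 * gaussianPDF 0 2 g := fun g => by
    rw [gaussianPDF, gaussianPDF, ← ENNReal.ofReal_mul (gaussianPDFReal_nonneg _ _ _),
      ← ENNReal.ofReal_mul (by positivity)]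
    congr 1
    simp only [gaussianPDFReal, NNReal.coe_one, NNReal.coe_ofNat]
    have h1 : √(2 * Real.pi * 2) = √(2 * Real.pi * 1) * √2 := by
      rw [← Real.sqrt_mul (by positivity)]; ring_nf
    rw [h1, mul_inv, mul_assoc, ← Real.exp_add]
    have h2 : -(g - 0) ^ 2 / (2 * 1) + g ^ 2 / 4 = -(g - 0) ^ 2 / (2 * 2) := by ring
    rw [h2]
    have : √(2 : ℝ) ≠ 0 := by positivity
    field_simp
  rw [gaussianReal_of_var_ne_zero _ one_ne_zero,
    lintegral_withDensity_eq_lintegral_mul _ (measurable_gaussianPDF 0 1) (by fun_prop)]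
  simp only [Pi.mul_apply, hpt]
  rw [lintegral_const_mul _ (measurable_gaussianPDF 0 2),
    lintegral_gaussianPDF_eq_one _ two_ne_zero, mul_one]

/-- Squares of subgaussian variables have exponential moments, by Gaussian decoupling. -/
lemma lintegral_exp_sq_le [IsProbabilityMeasure μ] {X : Ω → ℝ} {σ : ℝ≥0} (hσ : 0 < σ)
    (hm : Measurable X) (h : HasSubgaussianMGF X σ μ) :
    ∫⁻ ω, ENNReal.ofReal (Real.exp (X ω ^ 2 / (4 * σ))) ∂μ ≤ ENNReal.ofReal √2 := by
  have hσ' : (0 : ℝ) < σ := hσ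
  set c : ℝ := √(1 / (2 * σ))
  have hc : c ^ 2 = 1 / (2 * σ) := Real.sq_sqrt (by positivity)
  -- Since `E e^{tg} = e^{t²/2}` for a standard Gaussian `g`, the choice `c² = 1/(2σ)` linearizes
  -- the square in the exponent. After swapping the integrals, the subgaussian bound at `c * g`
  -- leaves exactly `e^{g²/4}`.
  have h1 : ∀ ω, ENNReal.ofReal (Real.exp (X ω ^ 2 / (4 * σ))) =
      ∫⁻ g, ENNReal.ofReal (Real.exp (c * X ω * g)) ∂(gaussianReal 0 1) := fun ω => by
    rw [← ofReal_integral_eq_lintegral_ofReal (integrable_exp_mul_gaussianReal _)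
      (ae_of_all _ fun g => (Real.exp_pos _).le)]
    have := congrFun (mgf_id_gaussianReal (μ := 0) (v := 1)) (c * X ω)
    simp only [mgf, id] at this
    rw [this]
    congr 2
    rw [mul_pow, hc]; simp; field_simp; norm_num
  simp_rw [h1]
  rw [lintegral_lintegral_swap (by fun_prop), ← lintegral_exp_sq_gaussianReal]
  refine lintegral_mono fun g => ?_
  have h2 : ∀ ω, c * X ω * g = (c * g) * X ω := fun ω => by ring
  simp_rw [h2]
  rw [← ofReal_integral_eq_lintegral_ofReal (h.integrable_exp_mul _)
      (ae_of_all _ fun g => (Real.exp_pos _).le)]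
  refine ENNReal.ofReal_le_ofReal ((h.mgf_le (c * g)).trans (Real.exp_le_exp.2 (le_of_eq ?_)))
  rw [mul_pow, hc]; field_simp; ring

lemma exp_le_one_add_add_sq (z : ℝ) : Real.exp z ≤ 1 + z + z ^ 2 * Real.exp |z| := by
  have := Complex.norm_exp_sub_sum_le_norm_mul_exp (z : ℂ) 2
  have e : Complex.exp z - ∑ m ∈ Finset.range 2, (z : ℂ) ^ m / m.factorial =
      ((Real.exp z - (1 + z) : ℝ) : ℂ) := by
    simp [Finset.sum_range_succ]
  rw [e, Complex.norm_real, Complex.norm_real, Real.norm_eq_abs, Real.norm_eq_abs, sq_abs] at this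
  linarith [le_abs_self (Real.exp z - (1 + z))]

/-- The moment generating function of a centred square of a subgaussian variable. -/
lemma mgf_sq_sub_one_le [IsProbabilityMeasure μ] {X : Ω → ℝ} {σ : ℝ≥0} (hσ : 0 < σ)
    (hm : Measurable X) (h : HasSubgaussianMGF X σ μ) (hvar : ∫ ω, X ω ^ 2 ∂μ = 1) {s : ℝ}
    (hs : |s| ≤ 1 / (8 * σ)) :
    Integrable (fun ω => Real.exp (s * (X ω ^ 2 - 1))) μ ∧
    mgf (fun ω => X ω ^ 2 - 1) μ s ≤
      Real.exp (512 * σ ^ 2 * Real.exp (1 / (4 * σ)) * s ^ 2) := by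
  have hσ' : (0 : ℝ) < σ := hσ
  have hfin : ∫⁻ ω, ENNReal.ofReal (Real.exp (X ω ^ 2 / (4 * σ))) ∂μ ≠ ∞ :=
    ((lintegral_exp_sq_le hσ hm h).trans_lt ENNReal.ofReal_lt_top).ne
  have hint : Integrable (fun ω => Real.exp (X ω ^ 2 / (4 * σ))) μ := by
    refine ⟨by fun_prop, ?_⟩
    rw [hasFiniteIntegral_iff_ofReal (ae_of_all _ fun ω => (Real.exp_pos _).le)]
    exact hfin.lt_top
  have hE : ∫ ω, Real.exp (X ω ^ 2 / (4 * σ)) ∂μ ≤ 2 := by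
    rw [integral_eq_lintegral_of_nonneg_ae (ae_of_all _ fun ω => (Real.exp_pos _).le)
      (by fun_prop)]
    refine ENNReal.toReal_le_of_le_ofReal (by norm_num) ((lintegral_exp_sq_le hσ hm h).trans ?_)
    refine ENNReal.ofReal_le_ofReal (Real.sqrt_le_iff.2 ⟨by norm_num, by norm_num⟩)
  have hX2 : Integrable (fun ω => X ω ^ 2) μ := by
    by_contra hcon
    rw [integral_undef hcon] at hvar
    norm_num at hvar
  set b : ℝ := 1 / (4 * σ) with hb
  have hb0 : 0 < b := by positivity
  have hs' : |s| ≤ b / 2 := hs.trans (le_of_eq (by rw [hb]; field_simp; norm_num))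
  -- `Z²` costs one factor `e^{b|Z|/2}` (from `t²/2 ≤ e^t`), the Taylor remainder another since `|s|
  -- ≤ b/2`; their product is absorbed by `e^{X²/(4σ)}`, of expectation at most 2.
  have hpt : ∀ ω, Real.exp (s * (X ω ^ 2 - 1)) ≤
      1 + s * (X ω ^ 2 - 1) + (8 / b ^ 2 * Real.exp b * s ^ 2) * Real.exp (X ω ^ 2 / (4 * σ)) := by
    intro ω
    set Z := X ω ^ 2 - 1
    have hZ : |Z| ≤ X ω ^ 2 + 1 := by
      rw [abs_le]; constructor <;> simp only [Z] <;> nlinarith [sq_nonneg (X ω)]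
    have h2 : (b / 2 * |Z|) ^ 2 / 2 ≤ Real.exp (b / 2 * |Z|) := by
      have := Real.quadratic_le_exp_of_nonneg (x := b / 2 * |Z|) (by positivity)
      nlinarith [show 0 ≤ b / 2 * |Z| by positivity]
    have h3 : Z ^ 2 ≤ 8 / b ^ 2 * Real.exp (b / 2 * |Z|) := by
      rw [← sq_abs, div_mul_eq_mul_div, le_div_iff₀ (by positivity)]
      nlinarith
    have h4 : Real.exp |s * Z| ≤ Real.exp (b / 2 * |Z|) := by
      rw [abs_mul]
      exact Real.exp_le_exp.2 (mul_le_mul_of_nonneg_right hs' (abs_nonneg _))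
    have h5 : Real.exp (b / 2 * |Z|) * Real.exp (b / 2 * |Z|) ≤
        Real.exp b * Real.exp (X ω ^ 2 / (4 * σ)) := by
      rw [← Real.exp_add, ← Real.exp_add]
      refine Real.exp_le_exp.2 ?_
      have : X ω ^ 2 / (4 * σ) = b * X ω ^ 2 := by rw [hb]; ring
      rw [this]
      nlinarith
    refine (exp_le_one_add_add_sq _).trans (add_le_add_right ?_ _)
    calc (s * Z) ^ 2 * Real.exp |s * Z|
        = s ^ 2 * Z ^ 2 * Real.exp |s * Z| := by ring
      _ ≤ s ^ 2 * (8 / b ^ 2 * Real.exp (b / 2 * |Z|)) * Real.exp (b / 2 * |Z|) := by gcongr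
      _ = 8 / b ^ 2 * s ^ 2 * (Real.exp (b / 2 * |Z|) * Real.exp (b / 2 * |Z|)) := by ring
      _ ≤ 8 / b ^ 2 * s ^ 2 * (Real.exp b * Real.exp (X ω ^ 2 / (4 * σ))) := by gcongr
      _ = _ := by ring
  have hi1 : Integrable (fun ω => 1 + s * (X ω ^ 2 - 1)) μ :=
    (integrable_const 1).add ((hX2.sub (integrable_const 1)).const_mul s)
  have hint' := hi1.add (hint.const_mul (8 / b ^ 2 * Real.exp b * s ^ 2))
  have hint1 : Integrable (fun ω => Real.exp (s * (X ω ^ 2 - 1))) μ :=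
    hint'.mono' (by fun_prop) (ae_of_all _ fun ω => by
      rw [Real.norm_eq_abs, abs_of_pos (Real.exp_pos _)]; exact hpt ω)
  refine ⟨hint1, (integral_mono hint1 hint' hpt).trans ?_⟩
  have hi2 : ∫ ω, (1 + s * (X ω ^ 2 - 1)) ∂μ = 1 := by
    have := integral_add (integrable_const (μ := μ) (1 : ℝ))
      ((hX2.sub (integrable_const (1 : ℝ))).const_mul s)
    simp only [Pi.sub_apply] at this
    rw [this, integral_const_mul, integral_sub hX2 (integrable_const 1), hvar]
    simp
  simp only [Pi.add_apply]
  rw [integral_add hi1 (hint.const_mul _), integral_const_mul, hi2]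
  have e : 8 / b ^ 2 = 128 * (σ : ℝ) ^ 2 := by
    rw [hb]; field_simp; norm_num
  rw [e]
  have h8 : 0 ≤ 128 * (σ : ℝ) ^ 2 * Real.exp b * s ^ 2 := by positivity
  have := Real.add_one_le_exp (512 * (σ : ℝ) ^ 2 * Real.exp b * s ^ 2)
  nlinarith

/-- Two-sided Chernoff bound for a sum of squares. -/
lemma measureReal_sum_sq_ge_le [IsProbabilityMeasure μ] {M : ℕ} {Y : Fin M → Ω → ℝ} {σ : ℝ≥0}
    (hσ : 0 < σ) (hm : ∀ m, Measurable (Y m)) (hY : ∀ m, HasSubgaussianMGF (Y m) σ μ)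
    (hvar : ∀ m, ∫ ω, Y m ω ^ 2 ∂μ = 1) (hind : iIndepFun Y μ) {η s : ℝ} (hs0 : 0 ≤ s)
    (hs : s ≤ 1 / (8 * σ)) (hs' : 512 * σ ^ 2 * Real.exp (1 / (4 * σ)) * s ≤ η / 2) :
    μ.real {ω | η * M ≤ |∑ m, (Y m ω ^ 2 - 1)|} ≤ 2 * Real.exp (-(s * η / 2 * M)) := by
  set C := 512 * (σ : ℝ) ^ 2 * Real.exp (1 / (4 * σ))
  set Z : Fin M → Ω → ℝ := fun m ω => Y m ω ^ 2 - 1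
  have hZm : ∀ m, Measurable (Z m) := fun m => ((hm m).pow_const 2).sub_const 1
  have hZind : iIndepFun Z μ :=
    hind.comp (fun _ y => y ^ 2 - 1) (fun _ => by fun_prop)
  have hmgf : ∀ t : ℝ, |t| ≤ 1 / (8 * σ) →
      Integrable (fun ω => Real.exp (t * (∑ m, Z m) ω)) μ ∧
        mgf (∑ m, Z m) μ t ≤ Real.exp (C * t ^ 2 * M) := fun t ht => by
    have hb := fun m => mgf_sq_sub_one_le hσ (hm m) (hY m) (hvar m) ht
    refine ⟨hZind.integrable_exp_mul_sum hZm fun m _ => (hb m).1, ?_⟩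
    rw [hZind.mgf_sum hZm]
    refine (Finset.prod_le_prod (fun m _ => mgf_nonneg) fun m _ => (hb m).2).trans ?_
    rw [Finset.prod_const, ← Real.exp_nat_mul]
    simp [C, mul_comm]
  have hexp : Real.exp (-s * (η * M)) * Real.exp (C * s ^ 2 * M) ≤
      Real.exp (-(s * η / 2 * M)) := by
    rw [← Real.exp_add]
    refine Real.exp_le_exp.2 ?_
    have : C * s * (s * M) ≤ η / 2 * (s * M) := mul_le_mul_of_nonneg_right hs' (by positivity)
    nlinarith
  have hsub : {ω | η * M ≤ |∑ m, (Y m ω ^ 2 - 1)|} ⊆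
      {ω | η * M ≤ (∑ m, Z m) ω} ∪ {ω | (∑ m, Z m) ω ≤ -(η * M)} := fun ω hω => by
    simp only [Set.mem_ofPred_eq, le_abs, Set.mem_union, Finset.sum_apply, Z] at hω ⊢
    exact hω.imp id fun h => by linarith
  have hs1 : |s| ≤ 1 / (8 * σ) := by rwa [abs_of_nonneg hs0]
  have hs2 : |-s| ≤ 1 / (8 * σ) := by rwa [abs_neg]
  have hup := measure_ge_le_exp_mul_mgf (μ := μ) (η * M) hs0 (hmgf s hs1).1
  have hlo := measure_le_le_exp_mul_mgf (μ := μ) (-(η * M)) (neg_nonpos.2 hs0) (hmgf (-s) hs2).1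
  refine (measureReal_mono hsub).trans ((measureReal_union_le _ _).trans ?_)
  have h1 := hup.trans (mul_le_mul_of_nonneg_left (hmgf s hs1).2 (Real.exp_pos _).le)
  have h2 := hlo.trans (mul_le_mul_of_nonneg_left (hmgf (-s) hs2).2 (Real.exp_pos _).le)
  have e : - -s * -(η * M) = -s * (η * M) := by ring
  rw [e, neg_sq] at h2
  linarith

lemma HasSubgaussianMGF.linearCombination {N : ℕ} {X : Fin N → Ω → ℝ} {σ : ℝ≥0}
    (hX : ∀ n, HasSubgaussianMGF (X n) σ μ) (hind : iIndepFun X μ) {a : Fin N → ℝ}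
    (ha : ∑ n, a n ^ 2 = 1) : HasSubgaussianMGF (fun ω => ∑ n, a n * X n ω) σ μ := by
  have h1 : ∀ n, HasSubgaussianMGF (fun ω => a n * X n ω) (.mk (a n ^ 2) (sq_nonneg _) * σ) μ :=
    fun n => (hX n).const_mul (a n)
  have := HasSubgaussianMGF.sum_of_iIndepFun (s := Finset.univ)
    (hind.comp (fun n x => a n * x) fun n => by fun_prop) fun n _ => h1 n
  have e : ∑ n, NNReal.mk (a n ^ 2) (sq_nonneg _) = 1 := by
    apply NNReal.eq
    push_cast
    exact ha
  rwa [← Finset.sum_mul, e, one_mul] at this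

lemma integral_sq_linearCombination [IsProbabilityMeasure μ] {N : ℕ} {X : Fin N → Ω → ℝ}
    (hX : ∀ n, MemLp (X n) 2 μ) (hind : iIndepFun X μ) (hmean : ∀ n, ∫ ω, X n ω ∂μ = 0)
    (hvar : ∀ n, ∫ ω, X n ω ^ 2 ∂μ = 1) {a : Fin N → ℝ} (ha : ∑ n, a n ^ 2 = 1) :
    ∫ ω, (∑ n, a n * X n ω) ^ 2 ∂μ = 1 := by
  have hL : ∀ n, MemLp (fun ω => a n * X n ω) 2 μ := fun n => (hX n).const_mul (a n)
  have hs := IndepFun.variance_sum (s := Finset.univ) (X := fun n ω => a n * X n ω) (μ := μ)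
    (fun n _ => hL n) fun i _ j _ hij =>
      (hind.indepFun hij).comp (φ := fun x => a i * x) (ψ := fun x => a j * x) (by fun_prop)
        (by fun_prop)
  have e : (∑ n, fun ω => a n * X n ω) = fun ω => ∑ n, a n * X n ω := by ext; simp
  have h0 : ∫ ω, ∑ n, a n * X n ω ∂μ = 0 := by
    rw [integral_finsetSum _ fun n _ => (hL n).integrable (by norm_num)]
    exact Finset.sum_eq_zero fun n _ => by rw [integral_const_mul, hmean, mul_zero]
  rw [e, variance_of_integral_eq_zero
    (memLp_finsetSum _ fun n _ => hL n).aestronglyMeasurable.aemeasurable h0] at hs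
  rw [hs, ← ha]
  refine Finset.sum_congr rfl fun n _ => ?_
  rw [variance_const_mul, variance_of_integral_eq_zero (hX n).aestronglyMeasurable.aemeasurable
    (hmean n), hvar, mul_one]

section Matrix

variable {M N : ℕ} {c₀ : ℝ} {A : Ω → Matrix (Fin M) (Fin N) ℝ}

/-- After dividing by `‖u‖`, the rescaled entries of `A u` are independent subgaussian variables of
variance one, so the bound for sums of squares applies row by row. -/
lemma IsSubgaussianMatrix.measureReal_deviation_le [IsProbabilityMeasure μ]
    (hA : IsSubgaussianMatrix μ c₀ A) (hM : 0 < M) {σ : ℝ≥0} (hσ : 0 < σ)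
    (hσ' : (σ : ℝ) = 2 * c₀ ^ 2) {η s : ℝ} (hs0 : 0 ≤ s)
    (hs : s ≤ 1 / (8 * σ)) (hs' : 512 * σ ^ 2 * Real.exp (1 / (4 * σ)) * s ≤ η / 2)
    {u : Fin N → ℝ} (hu : 0 < ∑ n, u n ^ 2) :
    μ.real {ω | η * ∑ n, u n ^ 2 ≤ |∑ m, (A ω *ᵥ u) m ^ 2 - ∑ n, u n ^ 2|} ≤
      2 * Real.exp (-(s * η / 2 * M)) := by
  set S := ∑ n, u n ^ 2
  have hMR : (0 : ℝ) < M := by exact_mod_cast hM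
  set a : Fin N → ℝ := fun n => u n / √S
  have ha : ∑ n, a n ^ 2 = 1 := by
    simp only [a, div_pow, Real.sq_sqrt hu.le]
    rw [← Finset.sum_div, div_self hu.ne']
  set X : Fin M → Fin N → Ω → ℝ := fun m n ω => √M * A ω m n
  have hXm : ∀ m n, Measurable (X m n) := fun m n => (hA.measurable m n).const_mul _
  have hXs : ∀ m n, HasSubgaussianMGF (X m n) σ μ := fun m n => by
    have e : ∀ t ω, t * X m n ω = √M * A ω m n * t := fun t ω => mul_comm _ _
    refine ⟨fun t => ?_, fun t => ?_⟩
    · simp_rw [e]; exact hA.mgf_integrable m n t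
    · simp only [mgf, e]
      refine (hA.mgf_le m n t).trans_eq ?_
      rw [hσ']; congr 1; ring
  have hXind : iIndepFun (fun (p : Fin M × Fin N) => X p.1 p.2) μ :=
    hA.indep.comp (fun _ x => √M * x) fun _ => by fun_prop
  have hXrow : ∀ m, iIndepFun (X m) μ := fun m => hXind.precomp (Prod.mk_right_injective m)
  have hmean : ∀ m n, ∫ ω, X m n ω ∂μ = 0 := fun m n => by
    rw [integral_const_mul, hA.mean, mul_zero]
  have hvar : ∀ m n, ∫ ω, X m n ω ^ 2 ∂μ = 1 := fun m n => by
    simp only [X, mul_pow, Real.sq_sqrt hMR.le]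
    rw [integral_const_mul, hA.variance]
    field_simp
  set Y : Fin M → Ω → ℝ := fun m ω => ∑ n, a n * X m n ω
  have hYind : iIndepFun Y μ :=
    (iIndepFun_rows (X := fun p => X p.1 p.2) (fun p => hXm _ _) hXind).comp
      (fun _ x => ∑ n, a n * x n) fun _ => by fun_prop
  have key := measureReal_sum_sq_ge_le hσ (Y := Y) (μ := μ)
    (fun m => Finset.measurable_sum _ fun n _ => (hXm m n).const_mul _)
    (fun m => HasSubgaussianMGF.linearCombination (hXs m) (hXrow m) ha)
    (fun m => integral_sq_linearCombination (fun n => (hXs m n).memLp 2) (hXrow m) (hmean m)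
      (hvar m) ha) hYind hs0 hs hs'
  convert key using 2
  ext ω
  have hY2 : ∀ m, Y m ω ^ 2 = M / S * (A ω *ᵥ u) m ^ 2 := fun m => by
    have : Y m ω = √M / √S * (A ω *ᵥ u) m := by
      simp only [Y, a, X, Matrix.mulVec, dotProduct, Finset.mul_sum]
      exact Finset.sum_congr rfl fun n _ => by ring
    rw [this, mul_pow, div_pow, Real.sq_sqrt hMR.le, Real.sq_sqrt hu.le]
  have e : ∑ m, (Y m ω ^ 2 - 1) = M / S * (∑ m, (A ω *ᵥ u) m ^ 2 - S) := by
    rw [Finset.sum_sub_distrib, Finset.sum_congr rfl fun m _ => hY2 m, ← Finset.mul_sum]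
    simp; field_simp
  simp only [Set.mem_ofPred_eq]
  rw [e, abs_mul, abs_of_pos (div_pos hMR hu), div_mul_eq_mul_div, le_div_iff₀ hu]
  constructor
  · intro h; nlinarith
  · intro h
    refine le_of_mul_le_mul_left ?_ hMR
    linarith

lemma norm_sq_mulE_toComplex (B : Matrix (Fin M) (Fin N) ℝ) (x : EuclideanSpace ℂ (Fin N)) :
    ‖mulE (toComplex B) x‖ ^ 2 = ∑ m, (B *ᵥ fun n => (x n).re) m ^ 2 +
      ∑ m, (B *ᵥ fun n => (x n).im) m ^ 2 := by
  rw [EuclideanSpace.norm_sq_eq, ← Finset.sum_add_distrib]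
  refine Finset.sum_congr rfl fun m _ => ?_
  rw [← Complex.normSq_eq_norm_sq, Complex.normSq_apply]
  simp [mulE, toComplex, Matrix.mulVec, dotProduct, pow_two]

lemma norm_sq_eq_re_add_im (x : EuclideanSpace ℂ (Fin N)) :
    ‖x‖ ^ 2 = ∑ n, (x n).re ^ 2 + ∑ n, (x n).im ^ 2 := by
  rw [EuclideanSpace.norm_sq_eq, ← Finset.sum_add_distrib]
  refine Finset.sum_congr rfl fun m _ => ?_
  rw [← Complex.normSq_eq_norm_sq, Complex.normSq_apply]
  ring

lemma IsSubgaussianMatrix.concentrates [IsProbabilityMeasure μ]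
    (hA : IsSubgaussianMatrix μ c₀ A) {σ : ℝ≥0} (hσ : 0 < σ)
    (hσ' : (σ : ℝ) = 2 * c₀ ^ 2) {η s : ℝ} (hs0 : 0 ≤ s)
    (hs : s ≤ 1 / (8 * σ)) (hs' : 512 * σ ^ 2 * Real.exp (1 / (4 * σ)) * s ≤ η / 2) :
    Concentrates μ A η (s * η / 2) := by
  intro x hx
  -- For `M = 0` the claimed bound is `4 ≥ 1`.
  rcases Nat.eq_zero_or_pos M with rfl | hM
  · refine prob_le_one.trans ?_
    simp
  -- If the real or imaginary part is zero, its deviation event in the non-strict form would be all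
  -- of `Ω`; it is replaced by the empty set. As `x ≠ 0`, one part is nonzero and supplies the
  -- strict inequality below.
  set T : (Fin N → ℝ) → Set Ω := fun u =>
    if 0 < ∑ n, u n ^ 2 then
      {ω | η * ∑ n, u n ^ 2 ≤ |∑ m, (A ω *ᵥ u) m ^ 2 - ∑ n, u n ^ 2|} else ∅
  have hT : ∀ u, μ.real (T u) ≤ 2 * Real.exp (-(s * η / 2 * M)) := fun u => by
    simp only [T]
    split_ifs with h
    · exact hA.measureReal_deviation_le hM hσ hσ' hs0 hs hs' h
    · simp; positivity
  have hsmall : ∀ u ω, ω ∉ T u → |∑ m, (A ω *ᵥ u) m ^ 2 - ∑ n, u n ^ 2| ≤ η * ∑ n, u n ^ 2 ∧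
      (0 < ∑ n, u n ^ 2 →
        |∑ m, (A ω *ᵥ u) m ^ 2 - ∑ n, u n ^ 2| < η * ∑ n, u n ^ 2) := fun u ω hω => by
    by_cases h : 0 < ∑ n, u n ^ 2
    · simp only [T, if_pos h, Set.mem_ofPred_eq, not_le] at hω
      exact ⟨hω.le, fun _ => hω⟩
    · have h0 : ∑ n, u n ^ 2 = 0 := le_antisymm (not_lt.1 h) (by positivity)
      have hu : u = 0 := by
        ext n
        have := (Finset.sum_eq_zero_iff_of_nonneg (fun n _ => sq_nonneg (u n))).1 h0 n
          (Finset.mem_univ n)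
        simpa using this
      exact ⟨by simp [hu], fun h' => absurd h' h⟩
  have hsub : {ω | η * ‖x‖ ^ 2 ≤ |‖mulE (toComplex (A ω)) x‖ ^ 2 - ‖x‖ ^ 2|} ⊆
      T (fun n => (x n).re) ∪ T (fun n => (x n).im) := by
    intro ω hω
    by_contra hcon
    rw [Set.mem_union, not_or] at hcon
    obtain ⟨r1, r2⟩ := hsmall _ _ hcon.1
    obtain ⟨i1, i2⟩ := hsmall _ _ hcon.2
    have hpos : 0 < ‖x‖ ^ 2 := by positivity
    rw [Set.mem_ofPred_eq, norm_sq_mulE_toComplex, norm_sq_eq_re_add_im] at hω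
    rw [norm_sq_eq_re_add_im] at hpos
    set p := ∑ n, (x n).re ^ 2
    set q := ∑ n, (x n).im ^ 2
    set P := ∑ m, (A ω *ᵥ fun n => (x n).re) m ^ 2
    set Q := ∑ m, (A ω *ᵥ fun n => (x n).im) m ^ 2
    have e : P + Q - (p + q) = (P - p) + (Q - q) := by ring
    rw [e] at hω
    have := abs_add_le (P - p) (Q - q)
    rcases lt_or_ge 0 p with hp | hp
    · linarith [r2 hp]
    · linarith [i2 (by linarith)]
  refine (measure_mono hsub).trans ?_
  rw [← ofReal_measureReal]
  refine ENNReal.ofReal_le_ofReal ((measureReal_union_le _ _).trans ?_)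
  linarith [hT fun n => (x n).re, hT fun n => (x n).im]

end Matrix

end Concentration

theorem exists_concentrates {c₀ η : ℝ} (hc : 0 < c₀) (hη : 0 < η) : ∃ c : ℝ, 0 < c ∧
    ∀ (Ω : Type u) [MeasurableSpace Ω] (μ : Measure Ω) [IsProbabilityMeasure μ] (M N : ℕ)
      (A : Ω → Matrix (Fin M) (Fin N) ℝ), IsSubgaussianMatrix μ c₀ A → Concentrates μ A η c := by
  set σ : ℝ≥0 := ⟨2 * c₀ ^ 2, by positivity⟩
  have hσ : 0 < σ := by
    rw [← NNReal.coe_pos]; change 0 < 2 * c₀ ^ 2; positivity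
  have hσ' : (0 : ℝ) < σ := hσ
  set C := 512 * (σ : ℝ) ^ 2 * Real.exp (1 / (4 * σ))
  have hC : 0 < C := by positivity
  set s := min (1 / (8 * (σ : ℝ))) (η / 2 / C)
  have hs : 0 < s := lt_min (by positivity) (by positivity)
  refine ⟨s * η / 2, by positivity, fun Ω _ μ _ M N A hA =>
    hA.concentrates hσ rfl hs.le (min_le_left _ _) ?_⟩
  rw [mul_comm, ← le_div_iff₀ hC]
  exact min_le_right _ _

/-! ### The multiband dictionary is nearly an isometry -/

section Dictionary

variable {N : ℕ}

lemma inner_eq_integral (x y : EuclideanSpace ℂ (Fin N)) :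
    inner ℂ x y =
      ∫ f in (-(1 / 2) : ℝ)..(1 / 2), trigSum y.ofLp f * conj (trigSum x.ofLp f) := by
  rw [integral_trigSum_mul_conj, EuclideanSpace.inner_eq_star_dotProduct, dotProduct_comm]

lemma integral_norm_mul_norm_le {a b γ : ℝ} (hab : a ≤ b) (hγ : 0 < γ) (x y : Fin N → ℂ) :
    ∫ f in a..b, ‖trigSum y f‖ * ‖trigSum x f‖ ≤
      1 / (2 * γ) * bandEnergy a b x + γ / 2 * bandEnergy a b y := by
  unfold bandEnergy
  rw [← intervalIntegral.integral_const_mul, ← intervalIntegral.integral_const_mul,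
    ← intervalIntegral.integral_add ((intervalIntegrable_sq_norm_trigSum _ _ _).const_mul _)
      ((intervalIntegrable_sq_norm_trigSum _ _ _).const_mul _)]
  refine intervalIntegral.integral_mono_on hab
    (Continuous.intervalIntegrable (by fun_prop) _ _)
    (Continuous.intervalIntegrable (by fun_prop) _ _) fun f _ => ?_
  have h := sq_nonneg (‖trigSum x f‖ - γ * ‖trigSum y f‖)
  have e : 1 / (2 * γ) * ‖trigSum x f‖ ^ 2 + γ / 2 * ‖trigSum y f‖ ^ 2 -
      ‖trigSum y f‖ * ‖trigSum x f‖ = (‖trigSum x f‖ - γ * ‖trigSum y f‖) ^ 2 / (2 * γ) := by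
    field_simp; ring
  have : 0 ≤ (‖trigSum x f‖ - γ * ‖trigSum y f‖) ^ 2 / (2 * γ) := by positivity
  linarith

/-- Vectors that are concentrated in, respectively away from, a band are nearly orthogonal. -/
lemma norm_inner_le_of_bandEnergy {a b γ : ℝ} (ha : -(1 / 2) ≤ a) (hab : a ≤ b) (hb : b ≤ 1 / 2)
    (hγ : 0 < γ) (x y : EuclideanSpace ℂ (Fin N))
    (hx : (1 - γ ^ 2) * ‖x‖ ^ 2 ≤ bandEnergy a b x.ofLp)
    (hy : bandEnergy a b y.ofLp ≤ γ ^ 2 * ‖y‖ ^ 2) :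
    ‖inner ℂ x y‖ ≤ γ * (‖x‖ ^ 2 + ‖y‖ ^ 2) := by
  have hi : ∀ c d, IntervalIntegrable
      (fun f => ‖trigSum y.ofLp f‖ * ‖trigSum x.ofLp f‖) volume c d := fun c d =>
    Continuous.intervalIntegrable (by fun_prop) _ _
  have h1 : ‖inner ℂ x y‖ ≤
      ∫ f in (-(1 / 2) : ℝ)..(1 / 2), ‖trigSum y.ofLp f‖ * ‖trigSum x.ofLp f‖ := by
    rw [inner_eq_integral]
    refine (intervalIntegral.norm_integral_le_integral_norm (by norm_num)).trans_eq ?_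
    simp
  have hx' := bandEnergy_half x
  have hy' := bandEnergy_half y
  rw [← bandEnergy_add _ a, ← bandEnergy_add a b] at hx' hy'
  rw [← intervalIntegral.integral_add_adjacent_intervals (hi _ a) (hi a _),
    ← intervalIntegral.integral_add_adjacent_intervals (hi a b) (hi b _)] at h1
  have e1 := integral_norm_mul_norm_le ha hγ x.ofLp y.ofLp
  have e2 := integral_norm_mul_norm_le hab hγ y.ofLp x.ofLp
  have e3 := integral_norm_mul_norm_le hb hγ x.ofLp y.ofLp
  simp_rw [mul_comm ‖trigSum x.ofLp _‖] at e2
  have n1 := bandEnergy_nonneg ha x.ofLp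
  have n2 := bandEnergy_nonneg ha y.ofLp
  have n3 := bandEnergy_nonneg hb x.ofLp
  have n4 := bandEnergy_nonneg hb y.ofLp
  have n5 := bandEnergy_nonneg hab y.ofLp
  -- Outside the band `x` carries at most `γ²‖x‖²`, so it takes the large weight `1/(2γ)`; inside
  -- the band the roles of `x` and `y` are exchanged.
  have hout : 1 / (2 * γ) * (bandEnergy (-(1 / 2)) a x.ofLp + bandEnergy b (1 / 2) x.ofLp) ≤
      γ / 2 * ‖x‖ ^ 2 := by
    rw [div_mul_eq_mul_div, one_mul, div_le_iff₀ (by positivity)]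
    nlinarith
  have hin : 1 / (2 * γ) * bandEnergy a b y.ofLp ≤ γ / 2 * ‖y‖ ^ 2 := by
    rw [div_mul_eq_mul_div, one_mul, div_le_iff₀ (by positivity)]
    nlinarith
  have hxin : γ / 2 * bandEnergy a b x.ofLp ≤ γ / 2 * ‖x‖ ^ 2 :=
    mul_le_mul_of_nonneg_left (by linarith) (by positivity)
  have hyout : γ / 2 * (bandEnergy (-(1 / 2)) a y.ofLp + bandEnergy b (1 / 2) y.ofLp) ≤
      γ / 2 * ‖y‖ ^ 2 := mul_le_mul_of_nonneg_left (by linarith) (by positivity)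
  linarith

/-- Modulation of a vector to the digital frequency `c`. -/
def modulate (c : ℝ) (v : Fin N → ℂ) : EuclideanSpace ℂ (Fin N) :=
  WithLp.toLp 2 fun n => exp (2 * Real.pi * (c : ℂ) * (n : ℕ) * I) * v n

lemma norm_modulate (c : ℝ) (v : Fin N → ℂ) : ‖modulate c v‖ ^ 2 = ∑ n, ‖v n‖ ^ 2 := by
  rw [EuclideanSpace.norm_sq_eq]
  refine Finset.sum_congr rfl fun n _ => ?_
  have : (2 * Real.pi * (c : ℂ) * (n : ℕ) * I) = ((2 * Real.pi * c * (n : ℕ) : ℝ) : ℂ) * I := by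
    push_cast; ring
  rw [modulate, norm_mul, this, norm_exp_ofReal_mul_I, one_mul]

lemma trigSum_modulate (c : ℝ) (v : Fin N → ℂ) (f : ℝ) :
    trigSum (modulate c v).ofLp f = trigSum v (f - c) := by
  refine Finset.sum_congr rfl fun n _ => ?_
  simp only [modulate]
  rw [mul_comm (exp _) (v n), mul_assoc, ← exp_add]
  congr 2
  push_cast; ring

lemma bandEnergy_modulate (c W : ℝ) (v : Fin N → ℂ) :
    bandEnergy (c - W) (c + W) (modulate c v).ofLp = bandEnergy (-W) W v := by
  unfold bandEnergy
  simp_rw [trigSum_modulate]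
  rw [intervalIntegral.integral_comp_sub_right (fun f => ‖trigSum v f‖ ^ 2)]
  congr 1 <;> ring

variable {W : ℝ} {lam : Fin N → ℝ} {s : Fin N → ℤ → ℝ} {J k : ℕ}

/-- The baseband signal synthesized from the coefficients of one block. -/
def baseband (s : Fin N → ℤ → ℝ) (hk : k ≤ N) (a : Fin k → ℂ) : Fin N → ℂ :=
  fun n => ∑ l, a l * (s (Fin.castLE hk l) ((n : ℕ) : ℤ) : ℂ)

/-- The coefficients are coordinates in an orthonormal eigenbasis of the Toeplitz matrix, where the
energy is diagonal. -/
lemma IsDPSS.bandEnergy_baseband (hs : IsDPSS N W lam s) (hk : k ≤ N) (a : Fin k → ℂ) :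
    bandEnergy (-W) W (baseband s hk a) = ∑ l, lam (Fin.castLE hk l) * ‖a l‖ ^ 2 := by
  obtain ⟨b, hb⟩ := hs.exists_orthonormalBasis
  have hx : WithLp.toLp 2 (baseband s hk a) = ∑ l, a l • b (Fin.castLE hk l) := by
    ext n
    simp [baseband, hb]
  have horth : Orthonormal ℂ fun l => b (Fin.castLE hk l) :=
    b.orthonormal.comp _ (Fin.castLE_injective hk)
  have := bandEnergy_eq_sum W b lam (fun i => by rw [hb i, hs.bandMatrix_mulVec])
    (WithLp.toLp 2 (baseband s hk a))
  rw [this, ← Finset.sum_subset (Finset.subset_univ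
    (Finset.univ.map (Fin.castLEEmb hk))), Finset.sum_map]
  · refine Finset.sum_congr rfl fun l _ => ?_
    rw [hx, Fin.castLEEmb_apply, horth.inner_right_fintype]
  · intro i _ hi
    have : inner ℂ (b i) (WithLp.toLp 2 (baseband s hk a)) = 0 := by
      rw [hx, inner_sum]
      refine Finset.sum_eq_zero fun l _ => ?_
      rw [inner_smul_right, b.orthonormal.2, mul_zero]
      rintro rfl
      exact hi (Finset.mem_map.2 ⟨l, Finset.mem_univ _, rfl⟩)
    simp [this]

lemma IsDPSS.sum_norm_sq_baseband (hs : IsDPSS N W lam s) (hk : k ≤ N) (a : Fin k → ℂ) :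
    ∑ n, ‖baseband s hk a n‖ ^ 2 = ∑ l, ‖a l‖ ^ 2 := by
  obtain ⟨b, hb⟩ := hs.exists_orthonormalBasis
  have hx : WithLp.toLp 2 (baseband s hk a) = ∑ l, a l • b (Fin.castLE hk l) := by
    ext n
    simp [baseband, hb]
  have horth : Orthonormal ℂ fun l => b (Fin.castLE hk l) :=
    b.orthonormal.comp _ (Fin.castLE_injective hk)
  have h := EuclideanSpace.norm_sq_eq (WithLp.toLp 2 (baseband s hk a))
  rw [← h, hx, @norm_sq_eq_re_inner ℂ, horth.inner_sum]
  simp only [Complex.conj_mul', map_sum]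
  norm_cast

/-- The contribution of the block `i` to the synthesized signal. -/
def blockSignal (s : Fin N → ℤ → ℝ) (hk : k ≤ N) (f : Fin J → ℝ)
    (α : EuclideanSpace ℂ (Fin J × Fin k)) (i : Fin J) : EuclideanSpace ℂ (Fin N) :=
  modulate (f i) (baseband s hk fun l => α (i, l))

/-- A dictionary of modulated prolate sequences with disjoint bands is nearly an isometry. -/
lemma IsDPSS.abs_norm_sq_sum_blockSignal_sub_le (hs : IsDPSS N W lam s) (hW : 0 ≤ W) (hk : k ≤ N)
    (f : Fin J → ℝ) (hlo : ∀ i, -(1 / 2) ≤ f i - W) (hhi : ∀ i, f i + W ≤ 1 / 2)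
    (hdisj : ∀ i j, i < j → f i + W ≤ f j - W) {γ : ℝ} (hγ : 0 < γ)
    (hlam : ∀ l : Fin k, 1 - γ ^ 2 ≤ lam (Fin.castLE hk l))
    (α : EuclideanSpace ℂ (Fin J × Fin k)) :
    |‖∑ i, blockSignal s hk f α i‖ ^ 2 - ‖α‖ ^ 2| ≤ 2 * J * γ * ‖α‖ ^ 2 := by
  set x := blockSignal s hk f α
  have hnorm : ∀ i, ‖x i‖ ^ 2 = ∑ l, ‖α (i, l)‖ ^ 2 := fun i => by
    simp only [x, blockSignal]
    rw [norm_modulate, hs.sum_norm_sq_baseband]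
  have hα : ‖α‖ ^ 2 = ∑ i, ‖x i‖ ^ 2 := by
    rw [EuclideanSpace.norm_sq_eq, Fintype.sum_prod_type]
    exact Finset.sum_congr rfl fun i _ => (hnorm i).symm
  have hin : ∀ i, (1 - γ ^ 2) * ‖x i‖ ^ 2 ≤ bandEnergy (f i - W) (f i + W) (x i).ofLp := fun i => by
    rw [hnorm]
    simp only [x, blockSignal]
    rw [bandEnergy_modulate, hs.bandEnergy_baseband, Finset.mul_sum]
    exact Finset.sum_le_sum fun l _ => mul_le_mul_of_nonneg_right (hlam l) (by positivity)
  have hout : ∀ i j, i ≠ j → bandEnergy (f i - W) (f i + W) (x j).ofLp ≤ γ ^ 2 * ‖x j‖ ^ 2 := by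
    intro i j hij
    have hj := hin j
    -- Signal `j` has at least `1 - γ²` of its energy in band `j`; as the bands do not overlap, at
    -- most `γ²` remains for band `i`.
    suffices bandEnergy (f i - W) (f i + W) (x j).ofLp +
        bandEnergy (f j - W) (f j + W) (x j).ofLp ≤ ‖x j‖ ^ 2 by linarith
    have order : ∀ a b c d : ℝ, -(1 / 2) ≤ a → a ≤ b → b ≤ c → c ≤ d → d ≤ 1 / 2 →
        bandEnergy a b (x j).ofLp + bandEnergy c d (x j).ofLp ≤ ‖x j‖ ^ 2 := by
      intro a b c d ha hab hbc hcd hd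
      rw [← bandEnergy_half, ← bandEnergy_add _ a (1 / 2), ← bandEnergy_add a b (1 / 2),
        ← bandEnergy_add b c (1 / 2), ← bandEnergy_add c d (1 / 2)]
      linarith [bandEnergy_nonneg ha (x j).ofLp, bandEnergy_nonneg hbc (x j).ofLp,
        bandEnergy_nonneg hd (x j).ofLp]
    rcases lt_or_gt_of_ne hij with h | h
    · exact order _ _ _ _ (hlo i) (by linarith) (hdisj i j h) (by linarith) (hhi j)
    · rw [add_comm]
      exact order _ _ _ _ (hlo j) (by linarith) (hdisj j i h) (by linarith) (hhi i)
  have hcross : ∀ i j, i ≠ j → ‖inner ℂ (x i) (x j)‖ ≤ γ * (‖x i‖ ^ 2 + ‖x j‖ ^ 2) :=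
    fun i j hij => norm_inner_le_of_bandEnergy (hlo i) (by linarith) (hhi i) hγ _ _ (hin i)
      (hout i j hij)
  have hexp : ‖∑ i, x i‖ ^ 2 - ‖α‖ ^ 2 =
      ∑ i, ∑ j, if i = j then 0 else (inner ℂ (x i) (x j)).re := by
    rw [@norm_sq_eq_re_inner ℂ, sum_inner, hα, map_sum, ← Finset.sum_sub_distrib]
    refine Finset.sum_congr rfl fun i _ => ?_
    rw [inner_sum, map_sum, ← Finset.add_sum_erase _ _ (Finset.mem_univ i),
      ← Finset.add_sum_erase Finset.univ (fun j => if i = j then (0 : ℝ) else _)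
        (Finset.mem_univ i), ← @norm_sq_eq_re_inner ℂ, if_pos rfl, add_sub_cancel_left, zero_add]
    refine Finset.sum_congr rfl fun j hj => ?_
    rw [if_neg (Finset.ne_of_mem_erase hj).symm]
    rfl
  rw [hexp]
  calc |∑ i, ∑ j, if i = j then 0 else (inner ℂ (x i) (x j)).re|
      ≤ ∑ i, ∑ j, γ * (‖x i‖ ^ 2 + ‖x j‖ ^ 2) := by
        refine (Finset.abs_sum_le_sum_abs _ _).trans (Finset.sum_le_sum fun i _ => ?_)
        refine (Finset.abs_sum_le_sum_abs _ _).trans (Finset.sum_le_sum fun j _ => ?_)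
        split_ifs with h
        · rw [abs_zero]; positivity
        · exact (Complex.abs_re_le_norm _).trans (hcross i j h)
    _ = 2 * J * γ * ‖α‖ ^ 2 := by
        rw [hα]
        simp only [mul_add, Finset.sum_add_distrib, ← Finset.mul_sum, Finset.sum_const,
          Finset.card_univ, Fintype.card_fin, nsmul_eq_mul]
        ring

lemma mulE_dpssDictionary (hk : k ≤ N) (Bnyq Bband Ts : ℝ)
    (α : EuclideanSpace ℂ (Fin J × Fin k)) :
    mulE (dpssDictionary s J k hk Bnyq Bband Ts) α =
      ∑ i, blockSignal s hk (fun i : Fin J => bandCenter Bnyq Bband i * Ts) α i := by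
  ext n
  simp only [mulE, Matrix.mulVec, dotProduct, dpssDictionary, Matrix.of_apply,
    Fintype.sum_prod_type, WithLp.ofLp_sum, Finset.sum_apply, blockSignal, modulate, baseband,
    Finset.mul_sum]
  exact Finset.sum_congr rfl fun i _ => Finset.sum_congr rfl fun l _ => by ring

/-- The multiband modulated DPSS dictionary is nearly an isometry. -/
lemma IsDPSS.abs_norm_sq_dpssDictionary_sub_le (hs : IsDPSS N W lam s) (hk : k ≤ N)
    {Bnyq Bband Ts ε C₁ C₂ : ℝ} {N₀ : ℕ} (hnyq : 0 < Bnyq) (hband : 0 < Bband)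
    (hJ : Bnyq = J * Bband) (hTs : 0 < Ts) (hTs' : Ts ≤ 1 / Bnyq) (hW : W = Bband * Ts / 2)
    (hε : 0 < ε) (hε' : ε < 1) (hN : 1 ≤ N) (hkN : (k : ℝ) = 2 * N * W * (1 - ε)) (hC₁ : 0 < C₁)
    (hnear : EigenvaluesNearOne W ε C₁ C₂ N₀) (hN₀ : N₀ ≤ N)
    (α : EuclideanSpace ℂ (Fin J × Fin k)) :
    |‖mulE (dpssDictionary s J k hk Bnyq Bband Ts) α‖ ^ 2 - ‖α‖ ^ 2| ≤
      2 * N * (√C₁ * Real.exp (-(C₂ * N / 2))) * ‖α‖ ^ 2 := by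
  have hNR : (1 : ℝ) ≤ N := by exact_mod_cast hN
  have hW0 : 0 < W := by rw [hW]; positivity
  have hJW : 2 * (J * W) ≤ 1 := by
    rw [le_div_iff₀ hnyq] at hTs'
    rw [hW]; rw [hJ] at hTs'; linarith
  set γ := √C₁ * Real.exp (-(C₂ * N / 2))
  have hγ : 0 < γ := by positivity
  have hγ2 : γ ^ 2 = C₁ * Real.exp (-(C₂ * N)) := by
    rw [mul_pow, Real.sq_sqrt hC₁.le, ← Real.exp_nat_mul]
    congr 2; push_cast; ring
  have hf : ∀ i : ℕ, bandCenter Bnyq Bband i * Ts = (2 * i + 1 - J) * W := fun i => by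
    rw [bandCenter, hJ, hW]; ring
  have hk0 : 0 < k := by
    have : (0 : ℝ) < k := by
      rw [hkN]
      have : 0 < 1 - ε := by linarith
      positivity
    exact_mod_cast this
  -- Each block has at least one column and `J * k ≤ N * (1 - ε)`, so the number of blocks in the
  -- bound may be replaced by `N`.
  have hJN : (J : ℝ) ≤ N := by
    have hk1 : (1 : ℝ) ≤ k := by exact_mod_cast hk0
    have h1 : (J : ℝ) * 1 ≤ J * k := mul_le_mul_of_nonneg_left hk1 (by positivity)
    have h2 : (J : ℝ) * k = N * (1 - ε) * (2 * (J * W)) := by rw [hkN]; ring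
    have h3 : N * (1 - ε) * (2 * (J * W)) ≤ N * (1 - ε) * 1 :=
      mul_le_mul_of_nonneg_left hJW (mul_nonneg (by linarith) (by linarith))
    nlinarith
  rw [mulE_dpssDictionary]
  refine (hs.abs_norm_sq_sum_blockSignal_sub_le hW0.le hk _ (fun i => ?_) (fun i => ?_)
    (fun i j hij => ?_) hγ (fun l => ?_) α).trans ?_
  · rw [hf]
    have : (0 : ℝ) ≤ (i : ℕ) * W := by positivity
    linarith
  · rw [hf]
    have : ((i : ℕ) + 1 : ℝ) * W ≤ J * W :=
      mul_le_mul_of_nonneg_right (by exact_mod_cast i.2) hW0.le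
    linarith
  · simp only [hf]
    have : ((i : ℕ) + 1 : ℝ) * W ≤ (j : ℕ) * W :=
      mul_le_mul_of_nonneg_right (by exact_mod_cast hij) hW0.le
    linarith
  · rw [hγ2]
    refine hnear N hN₀ lam s hs _ ?_
    rw [← hkN]
    exact_mod_cast l.2.le
  · gcongr

end Dictionary

/-! ### Linear algebra of blocks -/

section Blocks

variable {J k K : ℕ} {m n : Type*} [Fintype n]

lemma mulE_add (B : Matrix m n ℂ) (x y : EuclideanSpace ℂ n) :
    mulE B (x + y) = mulE B x + mulE B y := by
  simp [mulE, Matrix.mulVec_add]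

lemma mulE_sub (B : Matrix m n ℂ) (x y : EuclideanSpace ℂ n) :
    mulE B (x - y) = mulE B x - mulE B y := by
  simp [mulE, Matrix.mulVec_sub]

lemma mulE_smul (B : Matrix m n ℂ) (c : ℂ) (x : EuclideanSpace ℂ n) :
    mulE B (c • x) = c • mulE B x := by
  simp [mulE, Matrix.mulVec_smul]

/-- `mulE` as a linear map. -/
def mulEₗ (B : Matrix m n ℂ) : EuclideanSpace ℂ n →ₗ[ℂ] EuclideanSpace ℂ m where
  toFun := mulE B
  map_add' := mulE_add B
  map_smul' := mulE_smul B

lemma mulE_zero (B : Matrix m n ℂ) : mulE B 0 = 0 := (mulEₗ B).map_zero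

lemma mulE_one [DecidableEq n] (x : EuclideanSpace ℂ n) : mulE (1 : Matrix n n ℂ) x = x := by
  simp [mulE]

lemma residual_eq {B : Matrix m n ℂ} {a : EuclideanSpace ℂ n} {y e : EuclideanSpace ℂ m}
    (hy : y = mulE B a + e) (x : EuclideanSpace ℂ n) : residual B y x = mulE B (a - x) + e := by
  rw [residual, hy, mulE_sub]; abel

variable [Fintype m]

lemma mulE_mul {l : Type*} (A : Matrix l m ℂ) (B : Matrix m n ℂ)
    (x : EuclideanSpace ℂ n) : mulE (A * B) x = mulE A (mulE B x) := by
  simp [mulE, Matrix.mulVec_mulVec]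

lemma inner_mulE_conjTranspose (B : Matrix m n ℂ) (x : EuclideanSpace ℂ n)
    (y : EuclideanSpace ℂ m) : inner ℂ x (mulE Bᴴ y) = inner ℂ (mulE B x) y := by
  rw [EuclideanSpace.inner_eq_star_dotProduct, EuclideanSpace.inner_eq_star_dotProduct,
    dotProduct_comm, mulE, mulE, Matrix.dotProduct_mulVec, ← Matrix.star_mulVec, dotProduct_comm]

/-- The set of coefficient vectors supported on the blocks in `I`. -/
def blockSubmodule (I : Finset (Fin J)) : Submodule ℂ (EuclideanSpace ℂ (Fin J × Fin k)) where
  carrier := {α | SupportedOnBlocks I α}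
  add_mem' ha hb p hp := by simp [ha p hp, hb p hp]
  zero_mem' _ _ := rfl
  smul_mem' c a ha p hp := by simp [ha p hp]

lemma SupportedOnBlocks.mono {I I' : Finset (Fin J)} {α : EuclideanSpace ℂ (Fin J × Fin k)}
    (h : SupportedOnBlocks I α) (hI : I ⊆ I') : SupportedOnBlocks I' α :=
  fun p hp => h p fun hp' => hp (hI hp')

lemma SupportedOnBlocks.sub {I I' : Finset (Fin J)} {α β : EuclideanSpace ℂ (Fin J × Fin k)}
    (h : SupportedOnBlocks I α) (h' : SupportedOnBlocks I' β) :
    SupportedOnBlocks (I ∪ I') (α - β) :=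
  (blockSubmodule (I ∪ I')).sub_mem (h.mono Finset.subset_union_left)
    (h'.mono Finset.subset_union_right)

/-- The restriction of a coefficient vector to the blocks in `I`. -/
def blockRestrict (I : Finset (Fin J)) (α : EuclideanSpace ℂ (Fin J × Fin k)) :
    EuclideanSpace ℂ (Fin J × Fin k) :=
  WithLp.toLp 2 fun p => if p.1 ∈ I then α p else 0

variable {I I' : Finset (Fin J)} {α β x : EuclideanSpace ℂ (Fin J × Fin k)}

lemma blockRestrict_apply (p : Fin J × Fin k) :
    blockRestrict I α p = if p.1 ∈ I then α p else 0 := rfl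

lemma supportedOnBlocks_blockRestrict : SupportedOnBlocks I (blockRestrict I α) :=
  fun p hp => by rw [blockRestrict_apply, if_neg hp]

lemma SupportedOnBlocks.blockRestrict_compl (h : SupportedOnBlocks I α) :
    blockRestrict Iᶜ α = 0 := by
  ext p
  rw [blockRestrict_apply]
  split_ifs with hp
  · exact h p (Finset.mem_compl.1 hp)
  · rfl

lemma supportedOnBlocks_of_blockRestrict_compl (h : blockRestrict Iᶜ α = 0) :
    SupportedOnBlocks I α := fun p hp => by
  have := congrArg (fun v : EuclideanSpace ℂ (Fin J × Fin k) => v p) h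
  simpa [blockRestrict_apply, hp] using this

lemma blockRestrict_sub : blockRestrict I (α - β) = blockRestrict I α - blockRestrict I β := by
  ext p
  simp only [blockRestrict_apply, PiLp.sub_apply]
  split_ifs <;> simp

lemma blockRestrict_add_compl : blockRestrict I α + blockRestrict Iᶜ α = α := by
  ext p
  simp only [blockRestrict_apply, PiLp.add_apply, Finset.mem_compl]
  split_ifs <;> simp_all

lemma norm_sq_blockRestrict :
    ‖blockRestrict I α‖ ^ 2 = ∑ i ∈ I, ∑ l, ‖α (i, l)‖ ^ 2 := by
  rw [EuclideanSpace.norm_sq_eq, Fintype.sum_prod_type,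
    ← Finset.sum_subset (Finset.subset_univ I)]
  · refine Finset.sum_congr rfl fun i hi => Finset.sum_congr rfl fun l _ => ?_
    rw [blockRestrict_apply, if_pos hi]
  · intro i _ hi
    exact Finset.sum_eq_zero fun l _ => by rw [blockRestrict_apply, if_neg hi]; simp

lemma norm_sq_blockRestrict_add (α : EuclideanSpace ℂ (Fin J × Fin k)) (h : Disjoint I I') :
    ‖blockRestrict (I ∪ I') α‖ ^ 2 = ‖blockRestrict I α‖ ^ 2 + ‖blockRestrict I' α‖ ^ 2 := by
  simp only [norm_sq_blockRestrict]
  exact Finset.sum_union h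

lemma norm_sq_eq_blockRestrict (I : Finset (Fin J)) (α : EuclideanSpace ℂ (Fin J × Fin k)) :
    ‖α‖ ^ 2 = ‖blockRestrict I α‖ ^ 2 + ‖blockRestrict Iᶜ α‖ ^ 2 := by
  rw [← norm_sq_blockRestrict_add _ disjoint_compl_right, Finset.union_compl]
  congr 2
  ext p
  simp [blockRestrict_apply]

lemma norm_blockRestrict_le (I : Finset (Fin J)) (α : EuclideanSpace ℂ (Fin J × Fin k)) :
    ‖blockRestrict I α‖ ≤ ‖α‖ := by
  refine le_of_sq_le_sq ?_ (norm_nonneg _)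
  rw [norm_sq_eq_blockRestrict I α]
  linarith [sq_nonneg ‖blockRestrict Iᶜ α‖]

lemma norm_blockRestrict_mono (h : I ⊆ I') : ‖blockRestrict I α‖ ≤ ‖blockRestrict I' α‖ := by
  refine le_of_sq_le_sq ?_ (norm_nonneg _)
  simp only [norm_sq_blockRestrict]
  exact Finset.sum_le_sum_of_subset_of_nonneg h fun _ _ _ => by positivity

lemma SupportedOnBlocks.inner_eq (h : SupportedOnBlocks I α) :
    inner ℂ α β = inner ℂ α (blockRestrict I β) := by
  simp only [PiLp.inner_apply]
  refine Finset.sum_congr rfl fun p _ => ?_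
  rw [blockRestrict_apply]
  split_ifs with hp
  · rfl
  · rw [h p hp]; simp

lemma SupportedOnBlocks.inner_eq_zero (h : SupportedOnBlocks I α) (h' : SupportedOnBlocks I' β)
    (hd : Disjoint I I') : inner ℂ α β = 0 := by
  have : blockRestrict I β = 0 := by
    ext p
    rw [blockRestrict_apply]
    split_ifs with hp
    · exact h' p (Finset.disjoint_left.1 hd hp)
    · rfl
  rw [h.inner_eq, this, inner_zero_right]

lemma re_inner_blockRestrict_self :
    (inner ℂ (blockRestrict I α) α).re = ‖blockRestrict I α‖ ^ 2 := by
  rw [supportedOnBlocks_blockRestrict.inner_eq]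
  exact (@norm_sq_eq_re_inner ℂ _ _ _ _ _).symm

lemma mem_blockRange_one :
    α ∈ blockRange (1 : Matrix (Fin J × Fin k) (Fin J × Fin k) ℂ) I ↔ SupportedOnBlocks I α := by
  constructor
  · rintro ⟨β, hβ, rfl⟩
    rwa [mulE_one]
  · exact fun h => ⟨α, h, (mulE_one α).symm⟩

lemma SupportedOnBlocks.norm_compl_le (h : SupportedOnBlocks I β) :
    ‖blockRestrict Iᶜ α‖ ≤ ‖α - β‖ := by
  have : blockRestrict Iᶜ α = blockRestrict Iᶜ (α - β) := by
    rw [blockRestrict_sub, h.blockRestrict_compl, sub_zero]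
  rw [this]
  exact norm_blockRestrict_le _ _

lemma sub_blockRestrict : α - blockRestrict I α = blockRestrict Iᶜ α := by
  rw [sub_eq_iff_eq_add, add_comm, blockRestrict_add_compl]

/-- For the identity dictionary the best approximation on given blocks is coordinate restriction, so
distances become norms of the discarded blocks. -/
lemma infDist_blockRange_one :
    Metric.infDist α (blockRange (1 : Matrix (Fin J × Fin k) (Fin J × Fin k) ℂ) I) =
      ‖blockRestrict Iᶜ α‖ := by
  have hmem := mem_blockRange_one.2 (supportedOnBlocks_blockRestrict (I := I) (α := α))
  refine le_antisymm ?_ ((Metric.le_infDist ⟨_, hmem⟩).2 fun z hz => ?_)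
  · refine (Metric.infDist_le_dist_of_mem hmem).trans_eq ?_
    rw [dist_eq_norm, sub_blockRestrict]
  · rw [dist_eq_norm]
    exact (mem_blockRange_one.1 hz).norm_compl_le

/-! ### The support and projection steps for the identity dictionary -/

lemma IsBlockSupport.norm_compl_le
    (h : IsBlockSupport (1 : Matrix (Fin J × Fin k) (Fin J × Fin k) ℂ) α K I)
    (hI : I'.card ≤ K) : ‖blockRestrict Iᶜ α‖ ≤ ‖blockRestrict I'ᶜ α‖ := by
  have := h.2 I' hI
  rwa [infDist_blockRange_one, infDist_blockRange_one] at this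

lemma IsBlockSupport.supportedOnBlocks
    (h : IsBlockSupport (1 : Matrix (Fin J × Fin k) (Fin J × Fin k) ℂ) α K I)
    (hI : I'.card ≤ K) (hα : SupportedOnBlocks I' α) : SupportedOnBlocks I α := by
  have := h.norm_compl_le hI
  rw [hα.blockRestrict_compl, norm_zero] at this
  exact supportedOnBlocks_of_blockRestrict_compl (norm_le_zero_iff.1 this)

lemma IsBlockProjection.exists_eq
    (h : IsBlockProjection (1 : Matrix (Fin J × Fin k) (Fin J × Fin k) ℂ) α K β) :
    ∃ I : Finset (Fin J), I.card ≤ K ∧ SupportedOnBlocks I β ∧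
      ∀ I' : Finset (Fin J), I'.card ≤ K → ‖α - β‖ ≤ ‖blockRestrict I'ᶜ α‖ := by
  obtain ⟨I, hI, hβ, hmin⟩ := h
  refine ⟨I, hI.1, mem_blockRange_one.1 hβ, fun I' hI' => ?_⟩
  refine (hmin (blockRestrict I α) (mem_blockRange_one.2 supportedOnBlocks_blockRestrict)).trans ?_
  rw [sub_blockRestrict]
  exact hI.norm_compl_le hI'

lemma exists_isBlockSupport (Ψ : Matrix n (Fin J × Fin k) ℂ) (x : EuclideanSpace ℂ n) (K : ℕ) :
    ∃ I, IsBlockSupport Ψ x K I := by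
  obtain ⟨I, hI, hmin⟩ := Finset.exists_min_image
    (Finset.univ.filter fun I : Finset (Fin J) => I.card ≤ K)
    (fun I => Metric.infDist x (blockRange Ψ I)) ⟨∅, by simp⟩
  exact ⟨I, by simpa using hI, fun I' hI' => hmin I' (by simpa using hI')⟩

lemma exists_isBlockProjection_one (K : ℕ) (x : EuclideanSpace ℂ (Fin J × Fin k)) :
    ∃ p, IsBlockProjection (1 : Matrix (Fin J × Fin k) (Fin J × Fin k) ℂ) x K p := by
  obtain ⟨I, hI⟩ := exists_isBlockSupport (1 : Matrix (Fin J × Fin k) (Fin J × Fin k) ℂ) x K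
  refine ⟨blockRestrict I x, I, hI, mem_blockRange_one.2 supportedOnBlocks_blockRestrict,
    fun z hz => ?_⟩
  rw [sub_blockRestrict]
  exact (mem_blockRange_one.1 hz).norm_compl_le

lemma exists_leastSquares (B : Matrix m (Fin J × Fin k) ℂ) (y : EuclideanSpace ℂ m)
    (I : Finset (Fin J)) :
    ∃ z ∈ blockRange (1 : Matrix (Fin J × Fin k) (Fin J × Fin k) ℂ) I,
      ∀ w ∈ blockRange (1 : Matrix (Fin J × Fin k) (Fin J × Fin k) ℂ) I,
        ‖y - mulE B z‖ ≤ ‖y - mulE B w‖ := by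
  obtain ⟨v, ⟨z, hz, rfl⟩, hmin⟩ :=
    ((blockSubmodule I).map (mulEₗ B)).closed_of_finiteDimensional.exists_infDist_eq_dist
      ⟨0, Submodule.zero_mem _⟩ y
  refine ⟨z, mem_blockRange_one.2 hz, fun w hw => ?_⟩
  rw [← dist_eq_norm, ← dist_eq_norm]
  change dist y (mulEₗ B z) ≤ _
  rw [← hmin]
  exact Metric.infDist_le_dist_of_mem ⟨w, mem_blockRange_one.1 hw, rfl⟩

/-- Every minimum in the loop is attained: there are finitely many supports, and least squares runs
over a closed finite-dimensional subspace. This makes the existence of an output follow from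
termination. -/
lemma exists_isBBCoSaMPRun (B : Matrix m (Fin J × Fin k) ℂ) (y : EuclideanSpace ℂ m) (K : ℕ) :
    ∃ x, IsBBCoSaMPRun B (1 : Matrix (Fin J × Fin k) (Fin J × Fin k) ℂ) y K x := by
  have hstep : ∀ x, ∃ x',
      BBCoSaMPStep B (1 : Matrix (Fin J × Fin k) (Fin J × Fin k) ℂ) y K x x' := fun x => by
    obtain ⟨p, hp⟩ := exists_isBlockProjection_one (2 * K) (mulE Bᴴ (residual B y x))
    obtain ⟨It, hIt⟩ := exists_isBlockSupport
      (1 : Matrix (Fin J × Fin k) (Fin J × Fin k) ℂ) p (2 * K)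
    obtain ⟨I₀, hI₀⟩ := exists_isBlockSupport
      (1 : Matrix (Fin J × Fin k) (Fin J × Fin k) ℂ) x K
    obtain ⟨xt, hxt, hmin⟩ := exists_leastSquares B y (I₀ ∪ It)
    obtain ⟨x', hx'⟩ := exists_isBlockProjection_one K xt
    exact ⟨x', _, p, xt, It, I₀, rfl, hp, hIt, hI₀, ⟨hxt, hmin⟩, hx'⟩
  choose f hf using hstep
  exact ⟨fun l => Nat.rec 0 (fun _ x => f x) l, rfl, fun l => hf _⟩

/-! ### First-order conditions and polarization -/

section

variable {G : Type*} [NormedAddCommGroup G] [InnerProductSpace ℂ G] (c : ℝ) (a b : G)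

lemma re_inner_ofReal_smul_right :
    RCLike.re (inner ℂ a ((c : ℂ) • b)) = c * (inner ℂ a b).re := by
  rw [inner_smul_right]; simp

lemma norm_sq_add_smul :
    ‖a + (c : ℂ) • b‖ ^ 2 = ‖a‖ ^ 2 + 2 * (c * (inner ℂ a b).re) + ‖(c : ℂ) • b‖ ^ 2 := by
  rw [@norm_add_sq ℂ, re_inner_ofReal_smul_right]

lemma norm_sq_sub_smul :
    ‖a - (c : ℂ) • b‖ ^ 2 = ‖a‖ ^ 2 - 2 * (c * (inner ℂ a b).re) + ‖(c : ℂ) • b‖ ^ 2 := by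
  rw [@norm_sub_sq ℂ, re_inner_ofReal_smul_right]

/-- The first-order condition at a minimizer of the norm along a line. -/
lemma re_inner_eq_zero_of_norm_le {a b : G} (h : ∀ t : ℝ, ‖a‖ ≤ ‖a - (t : ℂ) • b‖) :
    (inner ℂ a b).re = 0 := by
  set ρ := (inner ℂ a b).re
  have key : ∀ t : ℝ, 2 * t * ρ ≤ t ^ 2 * ‖b‖ ^ 2 := fun t => by
    have h1 := pow_le_pow_left₀ (norm_nonneg a) (h t) 2
    rw [norm_sq_sub_smul, norm_smul, Complex.norm_real, mul_pow, Real.norm_eq_abs, sq_abs] at h1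
    linarith
  have hb : 0 < ‖b‖ ^ 2 + 1 := by positivity
  -- Near the optimal step `ρ / ‖b‖²`; the added 1 covers `b = 0`.
  have h2 := key (ρ / (‖b‖ ^ 2 + 1))
  have h3 : ρ ^ 2 * (‖b‖ ^ 2 + 2) ≤ 0 := by
    have e1 : 2 * (ρ / (‖b‖ ^ 2 + 1)) * ρ = 2 * ρ ^ 2 * (‖b‖ ^ 2 + 1) / (‖b‖ ^ 2 + 1) ^ 2 := by
      field_simp
    rw [e1, div_pow, div_mul_eq_mul_div, div_le_div_iff_of_pos_right (by positivity)] at h2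
    linarith
  by_contra hρ
  have : 0 < ρ ^ 2 * (‖b‖ ^ 2 + 2) := by positivity
  linarith

end

/-- Polarization of a quadratic bound on the deviation from an isometry. -/
lemma abs_re_inner_sub_le {V F F' : Type*} [NormedAddCommGroup V] [InnerProductSpace ℂ V]
    [NormedAddCommGroup F] [InnerProductSpace ℂ F] [NormedAddCommGroup F']
    [InnerProductSpace ℂ F'] (L : V →ₗ[ℂ] F) (P : V →ₗ[ℂ] F') (S : Submodule ℂ V) {δ : ℝ}
    (h : ∀ z ∈ S, |‖L z‖ ^ 2 - ‖P z‖ ^ 2| ≤ δ * ‖z‖ ^ 2) {u v : V} (hu : u ∈ S) (hv : v ∈ S) :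
    |(inner ℂ (L u) (L v)).re - (inner ℂ (P u) (P v)).re| ≤ δ * ‖u‖ * ‖v‖ := by
  rcases eq_or_ne u 0 with rfl | hu0
  · simp
  rcases eq_or_ne v 0 with rfl | hv0
  · simp
  have hu' := norm_pos_iff.2 hu0
  have hv' := norm_pos_iff.2 hv0
  -- Rescaling `v` to the norm of `u` optimizes the bound: comparing `u + c v` with `u - c v` gives
  -- `4c|b| ≤ δ(‖u + c v‖² + ‖u - c v‖²) = 4δ‖u‖²`.
  set c : ℝ := ‖u‖ / ‖v‖
  have hc : 0 < c := div_pos hu' hv'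
  have hcv : c * ‖v‖ = ‖u‖ := div_mul_cancel₀ _ hv'.ne'
  have hw : (c : ℂ) • v ∈ S := S.smul_mem _ hv
  have h1 := h _ (S.add_mem hu hw)
  have h2 := h _ (S.sub_mem hu hw)
  rw [map_add, map_add, map_smul, map_smul, norm_sq_add_smul, norm_sq_add_smul, norm_sq_add_smul] at h1
  rw [map_sub, map_sub, map_smul, map_smul, norm_sq_sub_smul, norm_sq_sub_smul, norm_sq_sub_smul] at h2
  have hnw : ‖(c : ℂ) • v‖ = ‖u‖ := by
    rw [norm_smul, Complex.norm_real, Real.norm_eq_abs, abs_of_pos hc, hcv]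
  rw [hnw] at h1 h2
  set b := (inner ℂ (L u) (L v)).re - (inner ℂ (P u) (P v)).re
  have hb : c * |b| ≤ δ * ‖u‖ ^ 2 := by
    have e : c * |b| = |c * b| := by rw [abs_mul, abs_of_pos hc]
    rw [e, abs_le]
    rw [abs_le] at h1 h2
    constructor <;> simp only [b] <;> nlinarith [h1.1, h1.2, h2.1, h2.2]
  refine le_of_mul_le_mul_left ?_ hc
  calc c * |b| ≤ δ * ‖u‖ ^ 2 := hb
    _ = c * (δ * ‖u‖ * ‖v‖) := by rw [← hcv]; ring

/-! ### Convergence of block-based CoSaMP under the block restricted isometry property -/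

/-- The restricted isometry property for vectors supported on at most `s` blocks. -/
def BlockRIP (B : Matrix m (Fin J × Fin k) ℂ) (s : ℕ) (δ : ℝ) : Prop :=
  ∀ I : Finset (Fin J), I.card ≤ s → ∀ α : EuclideanSpace ℂ (Fin J × Fin k),
    SupportedOnBlocks I α → |‖mulE B α‖ ^ 2 - ‖α‖ ^ 2| ≤ δ * ‖α‖ ^ 2

variable {B : Matrix m (Fin J × Fin k) ℂ} {s : ℕ}

lemma BlockRIP.abs_re_inner_sub_le (hB : BlockRIP B s (1 / 10)) (hI : I.card ≤ s)
    (hα : SupportedOnBlocks I α) (hβ : SupportedOnBlocks I β) :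
    |(inner ℂ (mulE B α) (mulE B β)).re - (inner ℂ α β).re| ≤ 1 / 10 * ‖α‖ * ‖β‖ :=
  DPSSRecovery.abs_re_inner_sub_le (mulEₗ B) LinearMap.id (blockSubmodule I)
    (fun z hz => hB I hI z hz) hα hβ

/-- Numerically, `1 + 1/10 ≤ 1.05²`; the companion lower bound uses `1 / 0.9 ≤ 1.1²`. -/
lemma BlockRIP.norm_mulE_le (hB : BlockRIP B s (1 / 10)) (hI : I.card ≤ s)
    (hα : SupportedOnBlocks I α) : ‖mulE B α‖ ≤ 1.05 * ‖α‖ := by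
  have := (abs_le.1 (hB I hI α hα)).2
  refine le_of_sq_le_sq ?_ (by positivity)
  nlinarith [sq_nonneg ‖α‖]

lemma BlockRIP.norm_le_mulE (hB : BlockRIP B s (1 / 10)) (hI : I.card ≤ s)
    (hα : SupportedOnBlocks I α) : ‖α‖ ≤ 1.1 * ‖mulE B α‖ := by
  have := (abs_le.1 (hB I hI α hα)).1
  refine le_of_sq_le_sq ?_ (by positivity)
  nlinarith [sq_nonneg ‖α‖]

lemma re_inner_le (v w : EuclideanSpace ℂ m) : |(inner ℂ v w).re| ≤ ‖v‖ * ‖w‖ :=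
  (Complex.abs_re_le_norm _).trans (norm_inner_le_norm v w)

/-- The identification step: the selected blocks capture most of the current error `r`. -/
lemma BlockRIP.norm_compl_le_of_identified (hB : BlockRIP B (4 * K) (1 / 10))
    {R It : Finset (Fin J)} (hR : R.card ≤ 2 * K) (hIt : It.card ≤ 2 * K)
    {r h : EuclideanSpace ℂ (Fin J × Fin k)} {e : EuclideanSpace ℂ m} (hr : SupportedOnBlocks R r)
    (hh : h = mulE Bᴴ (mulE B r + e)) (hsel : ‖blockRestrict Itᶜ h‖ ≤ ‖blockRestrict Rᶜ h‖) :
    ‖blockRestrict Itᶜ r‖ ≤ 0.2 * ‖r‖ + 2.1 * ‖e‖ := by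
  have hcard : (R ∪ It).card ≤ 4 * K := (Finset.card_union_le _ _).trans (by omega)
  have hrU : SupportedOnBlocks (R ∪ It) r := hr.mono Finset.subset_union_left
  have hinner : ∀ w, inner ℂ w h = inner ℂ (mulE B w) (mulE B r) + inner ℂ (mulE B w) e :=
    fun w => by rw [hh, inner_mulE_conjTranspose, inner_add_right]
  -- The selection discards no more of `h` than `R` would; cancelling the common blocks leaves this.
  have hle : ‖blockRestrict (R \ It) h‖ ≤ ‖blockRestrict (It \ R) h‖ := by
    refine le_of_sq_le_sq ?_ (norm_nonneg _)
    have h1 := pow_le_pow_left₀ (norm_nonneg _) hsel 2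
    have e1 := norm_sq_eq_blockRestrict It h
    have e2 := norm_sq_eq_blockRestrict R h
    have e3 := norm_sq_blockRestrict_add h (Finset.disjoint_sdiff (s := R) (t := It))
    have e4 := norm_sq_blockRestrict_add h (Finset.disjoint_sdiff (s := It) (t := R))
    rw [Finset.union_sdiff_self_eq_union] at e3 e4
    rw [Finset.union_comm] at e4
    linarith
  -- Off `R` the error `r` vanishes, so there `h` consists only of RIP deviation and noise.
  have hw : ‖blockRestrict (It \ R) h‖ ≤ 0.1 * ‖r‖ + 1.05 * ‖e‖ := by
    set w := blockRestrict (It \ R) h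
    have hws : SupportedOnBlocks (It \ R) w := supportedOnBlocks_blockRestrict
    have hwU : SupportedOnBlocks (R ∪ It) w :=
      hws.mono (Finset.sdiff_subset.trans Finset.subset_union_right)
    have h1 := (abs_le.1 (hB.abs_re_inner_sub_le hcard hwU hrU)).2
    have h2 := (abs_le.1 (re_inner_le (mulE B w) e)).2
    have h3 := hB.norm_mulE_le hcard hwU
    have h4 : inner ℂ w r = 0 := hws.inner_eq_zero hr Finset.sdiff_disjoint
    have h5 : (inner ℂ w h).re = ‖w‖ ^ 2 := re_inner_blockRestrict_self
    rw [hinner, Complex.add_re] at h5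
    rw [h4, Complex.zero_re, sub_zero] at h1
    rcases (norm_nonneg w).eq_or_lt with h0 | h0
    · rw [← h0]; positivity
    · refine le_of_mul_le_mul_left ?_ h0
      have h6 := mul_le_mul_of_nonneg_right h3 (norm_nonneg e)
      nlinarith
  -- On `R` the proxy `h` reproduces `r` up to the same deviation and noise, so blocks missed by
  -- `It` carry little of `r`.
  have hv : ‖blockRestrict (R \ It) r‖ ≤
      ‖blockRestrict (R \ It) h‖ + 0.1 * ‖r‖ + 1.05 * ‖e‖ := by
    set v := blockRestrict (R \ It) r
    have hvs : SupportedOnBlocks (R \ It) v := supportedOnBlocks_blockRestrict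
    have hvU : SupportedOnBlocks (R ∪ It) v :=
      hvs.mono (Finset.sdiff_subset.trans Finset.subset_union_left)
    have h1 := (abs_le.1 (hB.abs_re_inner_sub_le hcard hvU hrU)).1
    have h2 := (abs_le.1 (re_inner_le (mulE B v) e)).1
    have h3 := hB.norm_mulE_le hcard hvU
    have h5 : (inner ℂ v r).re = ‖v‖ ^ 2 := re_inner_blockRestrict_self
    have h7 : (inner ℂ v h).re ≤ ‖v‖ * ‖blockRestrict (R \ It) h‖ := by
      rw [hvs.inner_eq]
      exact (abs_le.1 (re_inner_le _ _)).2
    rw [hinner, Complex.add_re] at h7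
    rw [h5] at h1
    rcases (norm_nonneg v).eq_or_lt with h0 | h0
    · rw [← h0]; positivity
    · refine le_of_mul_le_mul_left ?_ h0
      have h6 := mul_le_mul_of_nonneg_right h3 (norm_nonneg e)
      nlinarith
  have hrr : blockRestrict Itᶜ r = blockRestrict (R \ It) r := by
    ext p
    simp only [blockRestrict_apply, Finset.mem_compl, Finset.mem_sdiff]
    by_cases hp : p.1 ∈ R
    · simp [hp]
    · simp [hp, hr p hp]
  rw [hrr]
  linarith

/-- The least-squares update is nearly as good as the best approximation on the merged blocks. -/
lemma BlockRIP.norm_sub_leastSquares_le (hB : BlockRIP B s (1 / 10))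
    {S : Finset (Fin J)} (hcard : (I ∪ S).card ≤ s)
    {a xt : EuclideanSpace ℂ (Fin J × Fin k)} {y e : EuclideanSpace ℂ m}
    (ha : SupportedOnBlocks S a) (hy : y = mulE B a + e) (hxt : SupportedOnBlocks I xt)
    (hmin : ∀ z, SupportedOnBlocks I z → ‖y - mulE B xt‖ ≤ ‖y - mulE B z‖) :
    0.9 * ‖a - xt‖ ≤ ‖blockRestrict Iᶜ a‖ + 1.05 * ‖e‖ := by
  set d := a - xt with hd
  set w := blockRestrict I d
  have hws : SupportedOnBlocks I w := supportedOnBlocks_blockRestrict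
  have hwU : SupportedOnBlocks (I ∪ S) w := hws.mono Finset.subset_union_left
  have hdU : SupportedOnBlocks (I ∪ S) d := by
    rw [Finset.union_comm]; exact ha.sub hxt
  have hres : y - mulE B xt = mulE B d + e := by
    rw [hy, hd, mulE_sub]; abel
  -- Normal equation of least squares, tested with the part `w` of the error lying in the merged
  -- blocks. The RIP turns it into a bound on `w`; outside these blocks the error is just `a`.
  have horth : (inner ℂ (y - mulE B xt) (mulE B w)).re = 0 := by
    refine re_inner_eq_zero_of_norm_le fun t => ?_
    have := hmin (xt + (t : ℂ) • w)
      ((blockSubmodule I).add_mem hxt ((blockSubmodule I).smul_mem _ hws))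
    rwa [mulE_add, mulE_smul, ← sub_sub] at this
  rw [hres, inner_add_left, Complex.add_re] at horth
  have h1 := (abs_le.1 (hB.abs_re_inner_sub_le hcard hdU hwU)).1
  have h2 := (abs_le.1 (re_inner_le e (mulE B w))).1
  have h3 := hB.norm_mulE_le hcard hwU
  have h5 : (inner ℂ d w).re = ‖w‖ ^ 2 := by
    rw [← re_inner_blockRestrict_self (I := I) (α := d), ← inner_conj_symm]
    exact Complex.conj_re _
  rw [h5] at h1
  have hw : ‖w‖ ≤ 0.1 * ‖d‖ + 1.05 * ‖e‖ := by
    rcases (norm_nonneg w).eq_or_lt with h0 | h0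
    · rw [← h0]; positivity
    · refine le_of_mul_le_mul_left ?_ h0
      have h6 := mul_le_mul_of_nonneg_left h3 (norm_nonneg e)
      nlinarith
  have hc : blockRestrict Iᶜ d = blockRestrict Iᶜ a := by
    rw [hd, blockRestrict_sub, hxt.blockRestrict_compl, sub_zero]
  have htri : ‖d‖ ≤ ‖w‖ + ‖blockRestrict Iᶜ a‖ := by
    rw [← hc]
    calc ‖d‖ = ‖w + blockRestrict Iᶜ d‖ := by rw [blockRestrict_add_compl]
      _ ≤ _ := norm_add_le _ _
  linarith

/-- The effect of one pass through the loop. -/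
lemma BlockRIP.step (hB : BlockRIP B (4 * K) (1 / 10)) {a x x' : EuclideanSpace ℂ (Fin J × Fin k)}
    {y e : EuclideanSpace ℂ m} (ha : ∃ S : Finset (Fin J), S.card ≤ K ∧ SupportedOnBlocks S a)
    (hy : y = mulE B a + e)
    (hx : ∃ S : Finset (Fin J), S.card ≤ K ∧ SupportedOnBlocks S x)
    (hstep : BBCoSaMPStep B (1 : Matrix (Fin J × Fin k) (Fin J × Fin k) ℂ) y K x x') :
    (∃ S : Finset (Fin J), S.card ≤ K ∧ SupportedOnBlocks S x') ∧
    ∃ I : Finset (Fin J), blockRestrict Iᶜ a = blockRestrict Iᶜ (a - x) ∧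
      0.45 * ‖a - x'‖ ≤ ‖blockRestrict Iᶜ a‖ + 1.05 * ‖e‖ ∧
      ‖blockRestrict Iᶜ a‖ ≤ 0.2 * ‖a - x‖ + 2.1 * ‖e‖ := by
  obtain ⟨S, hS, haS⟩ := ha
  obtain ⟨X, hX, hxX⟩ := hx
  obtain ⟨h, p, xt, It, I₀, hh, hp, hIt, hI₀, ⟨hxt, hmin⟩, hx'⟩ := hstep
  have hxt' := mem_blockRange_one.1 hxt
  have hxI₀ : SupportedOnBlocks I₀ x := hI₀.supportedOnBlocks hX hxX
  obtain ⟨I₂, hI₂, hx'I₂, hprune⟩ := hx'.exists_eq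
  refine ⟨⟨I₂, hI₂, hx'I₂⟩, I₀ ∪ It, ?_, ?_, ?_⟩
  · rw [blockRestrict_sub, (hxI₀.mono Finset.subset_union_left).blockRestrict_compl, sub_zero]
  · have hcard : (I₀ ∪ It ∪ S).card ≤ 4 * K := by
      refine (Finset.card_union_le _ _).trans ?_
      have := Finset.card_union_le I₀ It
      have := hI₀.1
      have := hIt.1
      omega
    have h1 := hB.norm_sub_leastSquares_le hcard haS hy hxt'
      (fun z hz => hmin z (mem_blockRange_one.2 hz))
    -- The true support `S` competes in the pruning, so pruning at most doubles the error and `0.9`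
    -- becomes `0.45`.
    have h2 : ‖xt - x'‖ ≤ ‖a - xt‖ :=
      (hprune S hS).trans (haS.norm_compl_le.trans_eq (norm_sub_rev _ _))
    have h3 : ‖a - x'‖ ≤ ‖a - xt‖ + ‖xt - x'‖ := norm_sub_le_norm_sub_add_norm_sub _ _ _
    linarith
  · have hcomp : ‖blockRestrict (I₀ ∪ It)ᶜ a‖ ≤ ‖blockRestrict Itᶜ (a - x)‖ := by
      have : blockRestrict (I₀ ∪ It)ᶜ a = blockRestrict (I₀ ∪ It)ᶜ (a - x) := by
        rw [blockRestrict_sub, (hxI₀.mono Finset.subset_union_left).blockRestrict_compl, sub_zero]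
      rw [this]
      exact norm_blockRestrict_mono (Finset.compl_subset_compl.2 Finset.subset_union_right)
    refine hcomp.trans ?_
    have hR : (S ∪ X).card ≤ 2 * K := (Finset.card_union_le _ _).trans (by omega)
    obtain ⟨I₁, hI₁, hpI₁, hpmin⟩ := hp.exists_eq
    have hpIt : SupportedOnBlocks It p := hIt.supportedOnBlocks hI₁ hpI₁
    refine hB.norm_compl_le_of_identified hR hIt.1 (haS.sub hxX) ?_
      (hpIt.norm_compl_le.trans (hpmin _ hR))
    rw [hh, residual_eq hy]

/-! ### Error along a run, termination and accuracy -/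

section Run

variable {a : EuclideanSpace ℂ (Fin J × Fin k)} {y e : EuclideanSpace ℂ m}
  {z : ℕ → EuclideanSpace ℂ (Fin J × Fin k)}

lemma BlockRIP.run_sparse (hB : BlockRIP B (4 * K) (1 / 10))
    (ha : ∃ S : Finset (Fin J), S.card ≤ K ∧ SupportedOnBlocks S a) (hy : y = mulE B a + e)
    (hz : IsBBCoSaMPRun B (1 : Matrix (Fin J × Fin k) (Fin J × Fin k) ℂ) y K z) (l : ℕ) :
    ∃ S : Finset (Fin J), S.card ≤ K ∧ SupportedOnBlocks S (z l) := by
  induction l with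
  | zero => exact ⟨∅, by simp, fun p _ => by rw [hz.1]; rfl⟩
  | succ l ih => exact (hB.step ha hy ih (hz.2 l)).1

/-- One pass sends the error `d` to at most `(0.2 d + 3.15‖e‖) / 0.45 ≤ d / 2 + 7‖e‖`, and `16 / 2 +
7 ≤ 16`. -/
lemma BlockRIP.run_error (hB : BlockRIP B (4 * K) (1 / 10))
    (ha : ∃ S : Finset (Fin J), S.card ≤ K ∧ SupportedOnBlocks S a) (hy : y = mulE B a + e)
    (hz : IsBBCoSaMPRun B (1 : Matrix (Fin J × Fin k) (Fin J × Fin k) ℂ) y K z) (l : ℕ) :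
    ‖a - z l‖ ≤ ‖a‖ / 2 ^ l + 16 * ‖e‖ := by
  induction l with
  | zero => rw [hz.1]; simp
  | succ l ih =>
    obtain ⟨I, -, h1, h2⟩ := (hB.step ha hy (hB.run_sparse ha hy hz l) (hz.2 l)).2
    have : ‖a‖ / 2 ^ (l + 1) = ‖a‖ / 2 ^ l / 2 := by rw [pow_succ, div_div]
    rw [this]
    linarith [norm_nonneg e, norm_nonneg (a - z l)]

lemma BlockRIP.sub_run_supported (hB : BlockRIP B (4 * K) (1 / 10))
    (ha : ∃ S : Finset (Fin J), S.card ≤ K ∧ SupportedOnBlocks S a) (hy : y = mulE B a + e)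
    (hz : IsBBCoSaMPRun B (1 : Matrix (Fin J × Fin k) (Fin J × Fin k) ℂ) y K z) (l : ℕ) :
    ∃ S : Finset (Fin J), S.card ≤ 4 * K ∧ SupportedOnBlocks S (a - z l) := by
  obtain ⟨S, hS, haS⟩ := ha
  obtain ⟨X, hX, hzX⟩ := hB.run_sparse ⟨S, hS, haS⟩ hy hz l
  exact ⟨S ∪ X, (Finset.card_union_le _ _).trans (by omega), haS.sub hzX⟩

/-- Without noise the signal is recovered exactly after finitely many iterations. -/
lemma BlockRIP.run_eventually_eq (hB : BlockRIP B (4 * K) (1 / 10))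
    (ha : ∃ S : Finset (Fin J), S.card ≤ K ∧ SupportedOnBlocks S a) (hy : y = mulE B a + e)
    (he : e = 0) (hz : IsBBCoSaMPRun B (1 : Matrix (Fin J × Fin k) (Fin J × Fin k) ℂ) y K z) :
    ∃ L, ∀ l, L ≤ l → z l = a := by
  -- `c` is a lower bound for the nonzero entries of `a`. Once the error is below `c`, no such entry
  -- can lie outside the next merged blocks, as there `a` coincides with the error; least squares
  -- and pruning are then exact.
  obtain ⟨c, hc, hcmin⟩ : ∃ c : ℝ, 0 < c ∧ ∀ p, a p ≠ 0 → c ≤ ‖a p‖ := by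
    rcases (Finset.univ.filter fun p => a p ≠ 0).eq_empty_or_nonempty with h | h
    · exact ⟨1, one_pos, fun p hp => absurd (Finset.mem_filter.2 ⟨Finset.mem_univ p, hp⟩)
        (by rw [h]; simp)⟩
    · obtain ⟨q, hq, hmin⟩ := Finset.exists_min_image _ (fun p => ‖a p‖) h
      exact ⟨‖a q‖, norm_pos_iff.2 (Finset.mem_filter.1 hq).2, fun p hp =>
        hmin p (Finset.mem_filter.2 ⟨Finset.mem_univ p, hp⟩)⟩
  obtain ⟨L, hL⟩ := exists_pow_lt_of_lt_one (div_pos hc (by positivity : 0 < ‖a‖ + 1))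
    (by norm_num : (1 / 2 : ℝ) < 1)
  refine ⟨L + 1, fun l hl => ?_⟩
  obtain ⟨l, rfl⟩ : ∃ n, l = n + 1 := ⟨l - 1, by omega⟩
  have herr := hB.run_error ha hy hz l
  rw [he, norm_zero, mul_zero, add_zero] at herr
  have hsmall : ‖a - z l‖ < c := by
    refine herr.trans_lt ?_
    have h1 : (1 / 2 : ℝ) ^ l ≤ (1 / 2) ^ L := pow_le_pow_of_le_one (by norm_num) (by norm_num)
      (by omega)
    have h2 := h1.trans_lt hL
    rw [lt_div_iff₀ (by positivity)] at h2
    have h3 : ‖a‖ / 2 ^ l = (1 / 2) ^ l * ‖a‖ := by rw [div_pow, one_pow]; ring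
    have h4 : (0 : ℝ) < (1 / 2) ^ l := by positivity
    rw [h3]
    linarith
  obtain ⟨I, hI, h1, -⟩ := (hB.step ha hy (hB.run_sparse ha hy hz l) (hz.2 l)).2
  have h0 : blockRestrict Iᶜ a = 0 := by
    ext p
    by_contra hp
    have hpI : p.1 ∈ Iᶜ := by
      by_contra hpI
      exact hp (by rw [blockRestrict_apply, if_neg hpI]; rfl)
    have hap : a p ≠ 0 := fun h => hp (by rw [blockRestrict_apply, h, ite_self]; rfl)
    have := congrArg (fun v : EuclideanSpace ℂ (Fin J × Fin k) => v p) hI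
    simp only [blockRestrict_apply, if_pos hpI] at this
    have hle := PiLp.norm_apply_le (a - z l) p
    rw [← this] at hle
    exact absurd (hcmin p hap) (not_le.2 (hle.trans_lt hsmall))
  rw [h0, he, norm_zero, norm_zero] at h1
  have : ‖a - z (l + 1)‖ ≤ 0 := by linarith
  exact (sub_eq_zero.1 (norm_le_zero_iff.1 this)).symm

/-- With noise the error is eventually at most `17‖e‖`, so the residual is at most `(1.05 * 17 +
1)‖e‖ ≤ 19‖e‖`. Without noise the halting threshold is zero, and exact recovery in finitely many
steps is needed. -/
lemma BlockRIP.terminates (hB : BlockRIP B (4 * K) (1 / 10))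
    (ha : ∃ S : Finset (Fin J), S.card ≤ K ∧ SupportedOnBlocks S a) (hy : y = mulE B a + e)
    (hz : IsBBCoSaMPRun B (1 : Matrix (Fin J × Fin k) (Fin J × Fin k) ℂ) y K z)
    {crit : StoppingCriterion m (Fin J × Fin k)} {τ θ : ℝ} (hτ : 19 ≤ τ)
    (hcrit : crit.IsAdequate ‖a‖ ‖e‖ τ θ) : ∃ l, crit l (z l) (residual B y (z l)) := by
  obtain ⟨L, hL⟩ := hcrit.halts
  suffices ∃ L', ∀ l, L' ≤ l → ‖residual B y (z l)‖ ≤ τ * ‖e‖ by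
    obtain ⟨L', hL'⟩ := this
    exact ⟨max L L', hL _ (le_max_left _ _) _ _ (hL' _ (le_max_right _ _))⟩
  by_cases he : e = 0
  · obtain ⟨L', hL'⟩ := hB.run_eventually_eq ha hy he hz
    refine ⟨L', fun l hl => ?_⟩
    rw [residual_eq hy, hL' l hl, sub_self, mulE_zero, he]
    simp
  · have he' : 0 < ‖e‖ := norm_pos_iff.2 he
    obtain ⟨L', hL'⟩ := exists_pow_lt_of_lt_one (div_pos he' (by positivity : 0 < ‖a‖ + 1))
      (by norm_num : (1 / 2 : ℝ) < 1)
    refine ⟨L', fun l hl => ?_⟩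
    have h1 : (1 / 2 : ℝ) ^ l ≤ (1 / 2) ^ L' :=
      pow_le_pow_of_le_one (by norm_num) (by norm_num) hl
    have h2 := h1.trans_lt hL'
    rw [lt_div_iff₀ (by positivity)] at h2
    have h3 : ‖a‖ / 2 ^ l = (1 / 2) ^ l * ‖a‖ := by rw [div_pow, one_pow]; ring
    have h4 : (0 : ℝ) < (1 / 2) ^ l := by positivity
    have herr := hB.run_error ha hy hz l
    rw [h3] at herr
    obtain ⟨S, hS, hsup⟩ := hB.sub_run_supported ha hy hz l
    have h5 := hB.norm_mulE_le hS hsup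
    rw [residual_eq hy]
    have h6 := norm_add_le (mulE B (a - z l)) e
    have h7 : 19 * ‖e‖ ≤ τ * ‖e‖ := mul_le_mul_of_nonneg_right hτ he'.le
    linarith

/-- If the residual is small, the lower RIP bound gives `1.1(θ + 1)‖e‖`; if enough iterations were
made, the geometric decay gives `(θ + 16)‖e‖`. The constant covers both, for `θ` of either sign. -/
lemma BlockRIP.output_error (hB : BlockRIP B (4 * K) (1 / 10))
    (ha : ∃ S : Finset (Fin J), S.card ≤ K ∧ SupportedOnBlocks S a) (hy : y = mulE B a + e)
    {crit : StoppingCriterion m (Fin J × Fin k)} {τ θ : ℝ}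
    (hcrit : crit.IsAdequate ‖a‖ ‖e‖ τ θ) {xhat : EuclideanSpace ℂ (Fin J × Fin k)}
    (hx : IsBBCoSaMPOutput crit B (1 : Matrix (Fin J × Fin k) (Fin J × Fin k) ℂ) y K xhat) :
    ‖a - xhat‖ ≤ (2 * |θ| + 20) * ‖e‖ := by
  obtain ⟨z, hz, l, hl, -, rfl⟩ := hx
  have hθ : θ * ‖e‖ ≤ |θ| * ‖e‖ := mul_le_mul_of_nonneg_right (le_abs_self θ) (norm_nonneg e)
  have hθ' : 0 ≤ |θ| * ‖e‖ := by positivity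
  rcases hcrit.accurate l _ _ hl with h | h
  · obtain ⟨S, hS, hsup⟩ := hB.sub_run_supported ha hy hz l
    have h1 := hB.norm_le_mulE hS hsup
    rw [residual_eq hy] at h
    have h2 : ‖mulE B (a - z l)‖ ≤ ‖mulE B (a - z l) + e‖ + ‖e‖ := by
      simpa using norm_sub_le (mulE B (a - z l) + e) e
    linarith [norm_nonneg e]
  · have h1 := hB.run_error ha hy hz l
    have h2 : ‖a‖ / 2 ^ l ≤ θ * ‖e‖ := by
      rw [div_le_iff₀ (by positivity)]; linarith
    linarith [norm_nonneg e]

lemma BlockRIP.exists_output (hB : BlockRIP B (4 * K) (1 / 10))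
    (ha : ∃ S : Finset (Fin J), S.card ≤ K ∧ SupportedOnBlocks S a) (hy : y = mulE B a + e)
    {crit : StoppingCriterion m (Fin J × Fin k)} {τ θ : ℝ} (hτ : 19 ≤ τ)
    (hcrit : crit.IsAdequate ‖a‖ ‖e‖ τ θ) :
    ∃ xhat, IsBBCoSaMPOutput crit B (1 : Matrix (Fin J × Fin k) (Fin J × Fin k) ℂ) y K xhat := by
  classical
  obtain ⟨z, hz⟩ := exists_isBBCoSaMPRun B y K
  have h := hB.terminates ha hy hz hτ hcrit
  exact ⟨_, z, hz, Nat.find h, Nat.find_spec h, fun i hi => Nat.find_min h hi, rfl⟩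

end Run

end Blocks

/-! ### Nets in the unit ball -/

section Nets

/-- A 1-separated subset of the ball of radius 2 of maximal cardinality is a net, since a point it
missed could be added; the volume bound for separated sets makes the maximum exist. -/
lemma exists_net_ball_two (V : Type*) [NormedAddCommGroup V] [NormedSpace ℝ V]
    [FiniteDimensional ℝ V] :
    ∃ s : Finset V, s.card ≤ 5 ^ Module.finrank ℝ V ∧ ∀ x, ‖x‖ ≤ 2 → ∃ c ∈ s, ‖x - c‖ ≤ 1 := by
  classical
  let P : ℕ → Prop := fun n => ∃ s : Finset V, s.card = n ∧ (∀ c ∈ s, ‖c‖ ≤ 2) ∧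
    ∀ c ∈ s, ∀ d ∈ s, c ≠ d → 1 ≤ ‖c - d‖
  have hP0 : P 0 := ⟨∅, by simp⟩
  obtain ⟨s, hs, hs2, hsep⟩ : P (Nat.findGreatest P (5 ^ Module.finrank ℝ V)) :=
    Nat.findGreatest_spec (Nat.zero_le _) hP0
  refine ⟨s, Besicovitch.card_le_of_separated s hs2 hsep, fun x hx => ?_⟩
  by_contra! hcon
  have hxs : x ∉ s := fun h => by simpa using (hcon x h).trans_le' zero_le_one
  have hins : P (s.card + 1) := by
    refine ⟨insert x s, Finset.card_insert_of_notMem hxs, ?_, ?_⟩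
    · intro c hc
      rcases Finset.mem_insert.1 hc with rfl | hc
      exacts [hx, hs2 c hc]
    · intro c hc d hd hcd
      rcases Finset.mem_insert.1 hc with rfl | hc' <;>
        rcases Finset.mem_insert.1 hd with rfl | hd'
      · exact absurd rfl hcd
      · exact (hcon d hd').le
      · rw [norm_sub_rev]; exact (hcon c hc').le
      · exact hsep c hc' d hd' hcd
  obtain ⟨t, ht, ht2, htsep⟩ := hins
  have := Nat.le_findGreatest (P := P)
    (ht ▸ Besicovitch.card_le_of_separated t ht2 htsep) ⟨t, ht, ht2, htsep⟩
  omega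

/-- Nets of the unit ball of geometrically decreasing radius. -/
lemma exists_net_pow (V : Type*) [NormedAddCommGroup V] [NormedSpace ℝ V]
    [FiniteDimensional ℝ V] (j : ℕ) :
    ∃ s : Finset V, s.card ≤ (5 ^ Module.finrank ℝ V) ^ j ∧
      ∀ x, ‖x‖ ≤ 1 → ∃ c ∈ s, ‖x - c‖ ≤ (1 / 2 : ℝ) ^ j := by
  classical
  obtain ⟨t, htc, ht⟩ := exists_net_ball_two V
  induction j with
  | zero => exact ⟨{0}, by simp, fun x hx => ⟨0, by simp, by simpa using hx⟩⟩
  | succ j ih =>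
    obtain ⟨s, hsc, hs⟩ := ih
    refine ⟨(s ×ˢ t).image fun p => p.1 + ((1 / 2 : ℝ) ^ (j + 1)) • p.2, ?_, fun x hx => ?_⟩
    · refine Finset.card_image_le.trans ?_
      rw [Finset.card_product, pow_succ]
      exact Nat.mul_le_mul hsc htc
    · obtain ⟨c, hc, hxc⟩ := hs x hx
      have hr : (0 : ℝ) < (1 / 2) ^ (j + 1) := by positivity
      have hr2 : (1 / 2 : ℝ) ^ j = 2 * (1 / 2) ^ (j + 1) := by rw [pow_succ]; ring
      -- The remainder `x - c`, magnified by `2^(j+1)`, lies in the ball of radius 2, so the fixed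
      -- net halves it.
      obtain ⟨d, hd, hxd⟩ := ht (((1 / 2 : ℝ) ^ (j + 1))⁻¹ • (x - c)) (by
        rw [norm_smul, norm_inv, Real.norm_eq_abs, abs_of_pos hr, inv_mul_le_iff₀ hr]
        linarith)
      refine ⟨_, Finset.mem_image_of_mem _ (Finset.mk_mem_product hc hd), ?_⟩
      have e : x - (c + ((1 / 2 : ℝ) ^ (j + 1)) • d) =
          ((1 / 2 : ℝ) ^ (j + 1)) • (((1 / 2 : ℝ) ^ (j + 1))⁻¹ • (x - c) - d) := by
        rw [smul_sub, smul_inv_smul₀ hr.ne']; abel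
      rw [e, norm_smul, Real.norm_eq_abs, abs_of_pos hr]
      exact mul_le_of_le_one_right hr.le hxd

/-- The radial projection onto the unit ball does not increase distances to its points. -/
lemma norm_sub_normalize_le {V : Type*} [NormedAddCommGroup V] [InnerProductSpace ℝ V] {x y : V} (hx : ‖x‖ ≤ 1) (hy : 1 ≤ ‖y‖) :
    ‖x - ‖y‖⁻¹ • y‖ ≤ ‖x - y‖ := by
  have hy0 : 0 < ‖y‖ := by linarith
  refine le_of_sq_le_sq ?_ (norm_nonneg _)
  rw [@norm_sub_sq ℝ, @norm_sub_sq ℝ, inner_smul_right, norm_smul, norm_inv, norm_norm,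
    inv_mul_cancel₀ hy0.ne']
  simp only [RCLike.re_to_real]
  have h1 : inner ℝ x y ≤ ‖y‖ :=
    (real_inner_le_norm x y).trans (mul_le_of_le_one_left hy0.le hx)
  have h2 : 0 ≤ 1 - ‖y‖⁻¹ := by
    have := inv_le_one_of_one_le₀ hy
    linarith
  have h3 := mul_le_mul_of_nonneg_left h1 h2
  have h4 : (1 - ‖y‖⁻¹) * ‖y‖ = ‖y‖ - 1 := by field_simp
  nlinarith [sq_nonneg (‖y‖ - 1)]

/-- Three halvings give radius `1/8` and `5 ^ 3 = 125` points per real dimension; net points outside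
the ball are moved onto the sphere without losing accuracy. -/
lemma exists_net_unit_ball (V : Type*) [NormedAddCommGroup V] [InnerProductSpace ℝ V]
    [FiniteDimensional ℝ V] :
    ∃ s : Finset V, s.card ≤ 125 ^ Module.finrank ℝ V ∧ (∀ c ∈ s, ‖c‖ ≤ 1) ∧
      ∀ x, ‖x‖ ≤ 1 → ∃ c ∈ s, ‖x - c‖ ≤ 1 / 8 := by
  classical
  obtain ⟨s, hsc, hs⟩ := exists_net_pow V 3
  refine ⟨s.image fun y => if ‖y‖ ≤ 1 then y else ‖y‖⁻¹ • y, ?_, ?_, fun x hx => ?_⟩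
  · refine Finset.card_image_le.trans (hsc.trans_eq ?_)
    rw [← pow_mul, mul_comm, pow_mul]; norm_num
  · intro c hc
    obtain ⟨y, -, rfl⟩ := Finset.mem_image.1 hc
    split_ifs with h
    · exact h
    · have : 0 < ‖y‖ := by linarith [not_le.1 h]
      rw [norm_smul, norm_inv, norm_norm, inv_mul_cancel₀ this.ne']
  · obtain ⟨y, hy, hxy⟩ := hs x hx
    refine ⟨_, Finset.mem_image_of_mem _ hy, ?_⟩
    have h8 : ((1 : ℝ) / 2) ^ 3 = 1 / 8 := by norm_num
    rw [h8] at hxy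
    split_ifs with h
    · exact hxy
    · exact (norm_sub_normalize_le hx (not_le.1 h).le).trans hxy

end Nets

/-! ### From a net to the whole space -/

lemma re_inner_add_sub {G : Type*} [NormedAddCommGroup G] [InnerProductSpace ℂ G] (a b : G) :
    (inner ℂ (a + b) (a - b)).re = ‖a‖ ^ 2 - ‖b‖ ^ 2 := by
  have e1 := @norm_sq_eq_re_inner ℂ _ _ _ _ a
  have e2 := @norm_sq_eq_re_inner ℂ _ _ _ _ b
  have e3 := @inner_re_symm ℂ _ _ _ _ a b
  simp only [RCLike.re_to_complex] at e1 e2 e3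
  rw [inner_add_left, inner_sub_right, inner_sub_right]
  simp only [Complex.add_re, Complex.sub_re]
  linarith

/-- A near isometry on a net of the unit ball is a near isometry everywhere. -/
lemma abs_norm_sq_sub_le_of_net {V F F' : Type*} [NormedAddCommGroup V] [InnerProductSpace ℂ V]
    [FiniteDimensional ℂ V] [NormedAddCommGroup F] [InnerProductSpace ℂ F] [NormedAddCommGroup F']
    [InnerProductSpace ℂ F'] (L : V →ₗ[ℂ] F) (P : V →ₗ[ℂ] F') {s : Finset V} {η : ℝ}
    (hs : ∀ c ∈ s, ‖c‖ ≤ 1) (hnet : ∀ x, ‖x‖ ≤ 1 → ∃ c ∈ s, ‖x - c‖ ≤ 1 / 8)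
    (h : ∀ c ∈ s, |‖L c‖ ^ 2 - ‖P c‖ ^ 2| ≤ η) (z : V) :
    |‖L z‖ ^ 2 - ‖P z‖ ^ 2| ≤ 4 / 3 * η * ‖z‖ ^ 2 := by
  have : ProperSpace V := FiniteDimensional.proper ℂ V
  have hLc : Continuous L := L.continuous_of_finiteDimensional
  have hPc : Continuous P := P.continuous_of_finiteDimensional
  obtain ⟨x, hx, hmax⟩ := (isCompact_closedBall (0 : V) 1).exists_isMaxOn
    ⟨0, by simp⟩ (f := fun z => |‖L z‖ ^ 2 - ‖P z‖ ^ 2|) (by fun_prop)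
  set S := |‖L x‖ ^ 2 - ‖P x‖ ^ 2| with hS
  have hx1 : ‖x‖ ≤ 1 := by simpa using hx
  have hS0 : 0 ≤ S := abs_nonneg _
  have hbound : ∀ z, |‖L z‖ ^ 2 - ‖P z‖ ^ 2| ≤ S * ‖z‖ ^ 2 := fun z => by
    rcases eq_or_ne z 0 with rfl | hz
    · simp
    have hz' := norm_pos_iff.2 hz
    have h1 := hmax (show ((‖z‖⁻¹ : ℝ) : ℂ) • z ∈ Metric.closedBall (0 : V) 1 by
      rw [mem_closedBall_zero_iff, norm_smul, Complex.norm_real, norm_inv, norm_norm,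
        inv_mul_cancel₀ hz'.ne'])
    simp only [Set.mem_ofPred_eq, map_smul, norm_smul, Complex.norm_real, norm_inv, norm_norm,
      mul_pow, ← mul_sub, abs_mul] at h1
    rw [abs_of_pos (by positivity), inv_pow, inv_mul_le_iff₀ (by positivity)] at h1
    linarith
  obtain ⟨c, hc, hxc⟩ := hnet x hx1
  -- At the maximizer `x`, the change from a net point `c` is the sesquilinear form at `x + c` and
  -- `x - c`, hence at most `S * 2 * (1/8) = S/4`. So `S ≤ S/4 + η`.
  have hpol := abs_re_inner_sub_le L P ⊤ (fun z _ => hbound z) (Submodule.mem_top (x := x + c))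
    (Submodule.mem_top (x := x - c))
  rw [map_add, map_add, map_sub, map_sub, re_inner_add_sub,
    re_inner_add_sub] at hpol
  have hsum : ‖x + c‖ ≤ 2 := (norm_add_le _ _).trans (by linarith [hs c hc])
  have hprod : S * ‖x + c‖ * ‖x - c‖ ≤ S * 2 * (1 / 8) := by gcongr
  have hxS : S ≤ S / 4 + η := by
    have e : ‖L x‖ ^ 2 - ‖P x‖ ^ 2 =
        (‖L x‖ ^ 2 - ‖L c‖ ^ 2 - (‖P x‖ ^ 2 - ‖P c‖ ^ 2)) + (‖L c‖ ^ 2 - ‖P c‖ ^ 2) := by ring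
    rw [hS, e]
    refine (abs_add_le _ _).trans (add_le_add (hpol.trans (hprod.trans_eq ?_)) (h c hc))
    rw [← e, ← hS]; ring
  refine (hbound z).trans (mul_le_mul_of_nonneg_right (by linarith) (by positivity))

/-! ### The block restricted isometry property of a random matrix times a dictionary -/

section UnionBound

variable {Ω : Type*} [MeasurableSpace Ω] {μ : Measure Ω} {M N J k K : ℕ}
  {A : Ω → Matrix (Fin M) (Fin N) ℝ} {η c β : ℝ}

lemma measurable_norm_sq_mulE (hA : ∀ m n, Measurable fun ω => A ω m n)
    (x : EuclideanSpace ℂ (Fin N)) :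
    Measurable fun ω => ‖mulE (toComplex (A ω)) x‖ ^ 2 := by
  simp_rw [norm_sq_mulE_toComplex, Matrix.mulVec, dotProduct]
  fun_prop

/-- The union bound: concentration holds simultaneously for finitely many vectors. -/
lemma Concentrates.exists_event [IsProbabilityMeasure μ] (h : Concentrates μ A η c)
    (hA : ∀ m n, Measurable fun ω => A ω m n) (T : Finset (EuclideanSpace ℂ (Fin N)))
    (hβ1 : β < 1) (hT : T.card * (4 * Real.exp (-(c * M))) < β) :
    ∃ E : Set Ω, MeasurableSet E ∧ ENNReal.ofReal (1 - β) < μ E ∧ ∀ ω ∈ E, ∀ x ∈ T,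
      |‖mulE (toComplex (A ω)) x‖ ^ 2 - ‖x‖ ^ 2| ≤ η * ‖x‖ ^ 2 := by
  classical
  set bad : EuclideanSpace ℂ (Fin N) → Set Ω := fun x =>
    {ω | η * ‖x‖ ^ 2 ≤ |‖mulE (toComplex (A ω)) x‖ ^ 2 - ‖x‖ ^ 2|}
  -- The zero vector is left out: its bad event is all of `Ω`, while the desired bound for it is
  -- trivial.
  set B : Set Ω := ⋃ x ∈ T.filter (· ≠ 0), bad x
  have hBm : MeasurableSet B := Finset.measurableSet_biUnion _ fun x _ =>
    measurableSet_le measurable_const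
      (_root_.continuous_abs.measurable.comp ((measurable_norm_sq_mulE hA x).sub_const _))
  have hβ : 0 < β := hT.trans_le' (by positivity)
  have hB : μ B < ENNReal.ofReal β := by
    refine lt_of_le_of_lt ?_ ((ENNReal.ofReal_lt_ofReal_iff hβ).2 hT)
    calc μ B ≤ ∑ x ∈ T.filter (· ≠ 0), μ (bad x) := measure_biUnion_finset_le _ _
      _ ≤ ∑ x ∈ T.filter (· ≠ 0), ENNReal.ofReal (4 * Real.exp (-(c * M))) :=
        Finset.sum_le_sum fun x hx => h x (Finset.mem_filter.1 hx).2
      _ ≤ ∑ x ∈ T, ENNReal.ofReal (4 * Real.exp (-(c * M))) :=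
        Finset.sum_le_sum_of_subset (Finset.filter_subset _ _)
      _ = ENNReal.ofReal (T.card * (4 * Real.exp (-(c * M)))) := by
        rw [Finset.sum_const, nsmul_eq_mul, ENNReal.ofReal_mul (p := T.card) (by positivity),
          ENNReal.ofReal_natCast]
  refine ⟨Bᶜ, hBm.compl, ?_, fun ω hω x hx => ?_⟩
  · have h1 : μ.real B < β := by
      rw [← ofReal_measureReal (measure_ne_top _ _)] at hB
      exact (ENNReal.ofReal_lt_ofReal_iff hβ).1 hB
    rw [← ofReal_measureReal, probReal_compl_eq_one_sub hBm,
      ENNReal.ofReal_lt_ofReal_iff (by linarith)]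
    linarith
  · rcases eq_or_ne x 0 with rfl | hx0
    · simp [mulE_zero]
    · by_contra hcon
      exact hω (Set.mem_biUnion (Finset.mem_filter.2 ⟨hx, hx0⟩) (not_le.1 hcon).le)

/-- The nets are real, so the complex dimension is doubled; this is the factor 2 in the exponent of
`125`. -/
lemma finrank_blockSubmodule_le (I : Finset (Fin J)) :
    Module.finrank ℝ (blockSubmodule (k := k) I) ≤ 2 * (I.card * k) := by
  rw [finrank_real_of_complex]
  refine Nat.mul_le_mul_left 2 ?_
  let F : blockSubmodule (k := k) I →ₗ[ℂ] (I × Fin k → ℂ) :=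
    { toFun := fun α p => α.1 (p.1.1, p.2)
      map_add' := fun _ _ => rfl
      map_smul' := fun _ _ => rfl }
  have hF : Function.Injective F := by
    rw [← LinearMap.ker_eq_bot, LinearMap.ker_eq_bot']
    intro α hα
    ext p
    by_cases hp : p.1 ∈ I
    · exact congrFun hα (⟨p.1, hp⟩, p.2)
    · exact α.2 p hp
  have := LinearMap.finrank_le_finrank_of_injective hF
  rwa [Module.finrank_fintype_fun_eq_card, Fintype.card_prod, Fintype.card_coe,
    Fintype.card_fin] at this

lemma exists_net_blockSubmodule (I : Finset (Fin J)) :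
    ∃ s : Finset (blockSubmodule (k := k) I), s.card ≤ 125 ^ (2 * (I.card * k)) ∧
      (∀ c ∈ s, ‖c‖ ≤ 1) ∧ ∀ x, ‖x‖ ≤ 1 → ∃ c ∈ s, ‖x - c‖ ≤ 1 / 8 := by
  let _ := InnerProductSpace.complexToReal (G := blockSubmodule (k := k) I)
  obtain ⟨s, h1, h2⟩ := exists_net_unit_ball (blockSubmodule (k := k) I)
  exact ⟨s, h1.trans (Nat.pow_le_pow_right (by norm_num) (finrank_blockSubmodule_le I)), h2⟩

lemma abs_norm_sq_mulE_sub_le_of_net (C : Matrix (Fin M) (Fin N) ℂ)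
    (Ψ : Matrix (Fin N) (Fin J × Fin k) ℂ) {I : Finset (Fin J)}
    {s : Finset (blockSubmodule (k := k) I)} (hs : ∀ c ∈ s, ‖c‖ ≤ 1)
    (hnet : ∀ x, ‖x‖ ≤ 1 → ∃ c ∈ s, ‖x - c‖ ≤ 1 / 8)
    (h : ∀ c ∈ s, |‖mulE C (mulE Ψ c.1)‖ ^ 2 - ‖mulE Ψ c.1‖ ^ 2| ≤ η)
    {α : EuclideanSpace ℂ (Fin J × Fin k)} (hα : SupportedOnBlocks I α) :
    |‖mulE C (mulE Ψ α)‖ ^ 2 - ‖mulE Ψ α‖ ^ 2| ≤ 4 / 3 * η * ‖α‖ ^ 2 := by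
  have key := abs_norm_sq_sub_le_of_net (V := blockSubmodule (k := k) I) (s := s) (η := η)
    (mulEₗ C ∘ₗ mulEₗ Ψ ∘ₗ (blockSubmodule I).subtype) (mulEₗ Ψ ∘ₗ (blockSubmodule I).subtype)
  exact key hs hnet h ⟨α, hα⟩

/-- A concentrating random matrix times a near isometry has the restricted isometry property. -/
lemma Concentrates.exists_event_blockRIP [IsProbabilityMeasure μ] {δ ρ : ℝ} (hδ : 0 ≤ δ)
    (h : Concentrates μ A (δ / √2) c) (hA : ∀ m n, Measurable fun ω => A ω m n)
    (Ψ : Matrix (Fin N) (Fin J × Fin k) ℂ) (hρ : ρ ≤ 0.05) (hsum : δ + ρ ≤ 1 / 10)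
    (hΨ : ∀ α, |‖mulE Ψ α‖ ^ 2 - ‖α‖ ^ 2| ≤ ρ * ‖α‖ ^ 2) {s : ℕ} (hs : s ≤ J)
    (hβ1 : β < 1) (hcount : (J.choose s * 125 ^ (2 * (s * k)) : ℝ) * (4 * Real.exp (-(c * M))) < β) :
    ∃ E : Set Ω, MeasurableSet E ∧ ENNReal.ofReal (1 - β) < μ E ∧
      ∀ ω ∈ E, BlockRIP (toComplex (A ω) * Ψ) s (1 / 10) := by
  classical
  choose net hcard hball hnet using fun I : Finset (Fin J) => exists_net_blockSubmodule (k := k) I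
  set T : Finset (EuclideanSpace ℂ (Fin N)) :=
    (Finset.powersetCard s Finset.univ).biUnion fun I =>
      (net I).image fun α : blockSubmodule (k := k) I => mulE Ψ α.1
  have hTcard : (T.card : ℝ) ≤ J.choose s * 125 ^ (2 * (s * k)) := by
    have : T.card ≤ J.choose s * 125 ^ (2 * (s * k)) := by
      refine Finset.card_biUnion_le.trans ?_
      calc _ ≤ ∑ I ∈ Finset.powersetCard s (Finset.univ : Finset (Fin J)),
            125 ^ (2 * (s * k)) := Finset.sum_le_sum fun I hI => by
              rw [← (Finset.mem_powersetCard.1 hI).2]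
              exact Finset.card_image_le.trans (hcard I)
        _ = _ := by simp [Finset.card_powersetCard]
    exact_mod_cast this
  obtain ⟨E, hE, hμ, hEx⟩ := h.exists_event hA T hβ1
    (lt_of_le_of_lt (mul_le_mul_of_nonneg_right hTcard (by positivity)) hcount)
  refine ⟨E, hE, hμ, fun ω hω I' hI' α hα => ?_⟩
  -- Smaller supports are enlarged to exactly `s` blocks, so the union bound only runs over the
  -- `J.choose s` sets of that size.
  obtain ⟨I, hI'I, hIcard⟩ := Finset.exists_superset_card_eq hI' (by simpa using hs)
  have h2 : (1.4 : ℝ) ≤ √2 := Real.le_sqrt_of_sq_le (by norm_num)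
  -- On the net `‖Ψ c‖² ≤ 1.05`, and `1.05 / √2 ≤ 3/4` compensates the loss `4/3` in passing from
  -- the net to the subspace.
  have hnetI : ∀ c ∈ net I, |‖mulE (toComplex (A ω)) (mulE Ψ c.1)‖ ^ 2 - ‖mulE Ψ c.1‖ ^ 2| ≤
      3 / 4 * δ := fun c hc => by
    have hcT : mulE Ψ c.1 ∈ T := Finset.mem_biUnion.2
      ⟨I, Finset.mem_powersetCard.2 ⟨Finset.subset_univ _, hIcard⟩,
        Finset.mem_image.2 ⟨c, hc, rfl⟩⟩
    refine (hEx ω hω _ hcT).trans ?_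
    have h3 := (abs_le.1 (hΨ c.1)).2
    have h4 : ‖c.1‖ ^ 2 ≤ 1 :=
      pow_le_one₀ (norm_nonneg _) (hball I c hc)
    have h5 : ‖mulE Ψ c.1‖ ^ 2 ≤ 1.05 := by
      nlinarith [sq_nonneg ‖c.1‖]
    calc δ / √2 * ‖mulE Ψ c.1‖ ^ 2 ≤ δ / 1.4 * 1.05 := by gcongr
      _ = 3 / 4 * δ := by ring
  have key := abs_norm_sq_mulE_sub_le_of_net (toComplex (A ω)) Ψ (hball I) (hnet I) hnetI
    (hα.mono hI'I)
  have e : 4 / 3 * (3 / 4 * δ) = δ := by ring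
  rw [e] at key
  rw [mulE_mul]
  have h6 := abs_sub_le (‖mulE (toComplex (A ω)) (mulE Ψ α)‖ ^ 2) (‖mulE Ψ α‖ ^ 2) (‖α‖ ^ 2)
  have h7 := hΨ α
  have h8 : (δ + ρ) * ‖α‖ ^ 2 ≤ 1 / 10 * ‖α‖ ^ 2 :=
    mul_le_mul_of_nonneg_right hsum (by positivity)
  linarith

end UnionBound

/-! ### Counting supports -/

lemma choose_le_exp {J s : ℕ} (hs : 0 < s) :
    (J.choose s : ℝ) ≤ (Real.exp 1 * J / s) ^ s := by
  have h1 : (J.choose s : ℝ) ≤ (J : ℝ) ^ s / s.factorial := Nat.choose_le_pow_div s J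
  have h2 := Real.pow_div_factorial_le_exp (s : ℝ) (by positivity) s
  have hs' : (0 : ℝ) < (s : ℝ) ^ s := by positivity
  refine h1.trans ?_
  rw [div_pow, mul_pow, ← Real.exp_nat_mul, mul_one, le_div_iff₀ hs']
  calc (J : ℝ) ^ s / s.factorial * s ^ s = (s : ℝ) ^ s / s.factorial * J ^ s := by ring
    _ ≤ Real.exp s * J ^ s := by gcongr

/-- If `4K ≤ J`, use `J.choose s ≤ (eJ/s)^s`. Otherwise there is only one support, but the logarithm
on the right may be negative; `log x ≥ 1 - 1/x` bounds it, and since `log 125 ≥ 4` the surplus of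
`8K` over `2J` dimensions pays for it. -/
lemma count_lt {J K k : ℕ} (hK : 1 ≤ K) (hKJ : K ≤ J) (hk : 1 ≤ k) {Λ : ℝ}
    (hΛ : Real.log 420 ≤ Λ) :
    (J.choose (min (4 * K) J) * 125 ^ (2 * (min (4 * K) J * k)) : ℝ) <
      Real.exp (8 * K * (k * Λ + Real.log (Real.exp 1 * J / (4 * K)))) := by
  have hKR : (1 : ℝ) ≤ K := by exact_mod_cast hK
  have hkR : (1 : ℝ) ≤ k := by exact_mod_cast hk
  have hKJR : (K : ℝ) ≤ J := by exact_mod_cast hKJ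
  have hJ : (0 : ℝ) < J := by linarith
  have hlog : Real.log 125 < Real.log 420 := Real.log_lt_log (by norm_num) (by norm_num)
  have hlog4 : 4 ≤ Real.log 125 := by
    rw [Real.le_log_iff_exp_le (by norm_num)]
    have h1 := Real.exp_one_lt_d9
    have h2 : Real.exp 4 = Real.exp 1 ^ 4 := by rw [← Real.exp_nat_mul]; norm_num
    rw [h2]
    calc Real.exp 1 ^ 4 ≤ 2.7182818286 ^ 4 := by gcongr
      _ ≤ 125 := by norm_num
  have h125 : ∀ n : ℕ, (125 : ℝ) ^ n = Real.exp (n * Real.log 125) := fun n => by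
    rw [Real.exp_nat_mul, Real.exp_log (by norm_num)]
  have hKk : (0 : ℝ) < K * k := by positivity
  have hmain : (K : ℝ) * k * Real.log 125 < K * k * Λ := by
    apply mul_lt_mul_of_pos_left _ hKk; linarith
  rcases le_or_gt (4 * K) J with h4 | h4
  · have h4R : (4 * K : ℝ) ≤ J := by exact_mod_cast h4
    rw [min_eq_left h4, h125]
    set x := Real.exp 1 * J / (4 * K) with hx
    have hx1 : 1 ≤ x := by
      rw [hx, le_div_iff₀ (by positivity)]
      nlinarith [Real.add_one_le_exp (1 : ℝ)]
    have hch : (J.choose (4 * K) : ℝ) ≤ Real.exp ((4 * K : ℕ) * Real.log x) := by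
      rw [Real.exp_nat_mul, Real.exp_log (by linarith)]
      have := choose_le_exp (J := J) (s := 4 * K) (by omega)
      push_cast at this
      exact this
    refine (mul_le_mul_of_nonneg_right hch (Real.exp_pos _).le).trans_lt ?_
    rw [← Real.exp_add]
    refine Real.exp_lt_exp.2 ?_
    have hl := Real.log_nonneg hx1
    push_cast
    nlinarith
  · have h4R : (J : ℝ) < 4 * K := by exact_mod_cast h4
    rw [min_eq_right h4.le, Nat.choose_self, Nat.cast_one, one_mul, h125]
    refine Real.exp_lt_exp.2 ?_
    have hl : Real.log (Real.exp 1 * J / (4 * K)) ≥ 2 - 4 * K / J := by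
      have h1 := Real.one_sub_inv_le_log_of_pos (x := J / (4 * K)) (by positivity)
      rw [mul_div_assoc, Real.log_mul (Real.exp_pos _).ne' (by positivity), Real.log_exp]
      rw [inv_div] at h1
      linarith
    have h2 : 8 * K * (4 * K / J - 2) ≤ 4 * (8 * K - 2 * J : ℝ) := by
      have e : 8 * K * (4 * K / J - 2) = 16 * K * (2 * K - J) / (J : ℝ) := by field_simp; ring
      rw [e, div_le_iff₀ hJ]
      nlinarith
    have h3 : 4 * (8 * K - 2 * J : ℝ) ≤ k * Real.log 125 * (8 * K - 2 * J) := by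
      refine mul_le_mul_of_nonneg_right ?_ (by linarith)
      nlinarith
    have h5 : 8 * K * Real.log (Real.exp 1 * J / (4 * K)) ≥ 8 * K * (2 - 4 * K / J) :=
      mul_le_mul_of_nonneg_left hl (by positivity)
    push_cast
    nlinarith

end DPSSRecovery
end

/-! ### Assembly of the theorem -/

theorem mainTheorem12 :
    -- the constants `C₁`, `C₂`, `N₀` exist
    (∃ C₁ : ℝ, 0 < C₁ ∧ ∀ W ε : ℝ, 0 < W → W < 1 / 2 → 0 < ε → ε < 1 →
      ∃ C₂ : ℝ, 0 < C₂ ∧ ∃ N₀ : ℕ, EigenvaluesNearOne W ε C₁ C₂ N₀) ∧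
    -- the concentration constant exists and depends only on `η` and `c₀`
    (∀ c₀ η : ℝ, 0 < c₀ → 0 < η → ∃ c : ℝ, 0 < c ∧
      ∀ (Ω : Type u) [MeasurableSpace Ω] (μ : Measure Ω) [IsProbabilityMeasure μ] (M N : ℕ)
        (A : Ω → Matrix (Fin M) (Fin N) ℝ),
        IsSubgaussianMatrix μ c₀ A → Concentrates μ A η c) ∧
    -- the recovery guarantee, for all such constants
    (∃ (τ₀ : ℝ) (κ₂ : ℝ → ℝ → ℝ), 0 < τ₀ ∧ (∀ a θ, 1 < κ₂ a θ) ∧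
      -- the bands, the sampling interval, the half-bandwidth `W` and the block length `k`
      ∀ (Bnyq Bband Ts W ε : ℝ) (J N k K : ℕ) (hkN : k ≤ N),
        0 < Bnyq → 0 < Bband → Bnyq = J * Bband →
        0 < Ts → Ts ≤ 1 / Bnyq → W = Bband * Ts / 2 → W < 1 / 2 →
        0 < ε → ε < 1 → 1 ≤ N → (k : ℝ) = 2 * N * W * (1 - ε) →
        1 ≤ K → K ≤ J →
      ∀ (C₁ C₂ : ℝ) (N₀ : ℕ), 0 < C₁ → 0 < C₂ → EigenvaluesNearOne W ε C₁ C₂ N₀ → N₀ ≤ N →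
      -- the dictionary
      ∀ (lam : Fin N → ℝ) (s : Fin N → ℤ → ℝ), IsDPSS N W lam s →
      ∀ Ψ : Matrix (Fin N) (Fin J × Fin k) ℂ, Ψ = dpssDictionary s J k hkN Bnyq Bband Ts →
      ∀ δ β : ℝ, 0 < δ → δ < 0.1 - 6 * N * √C₁ * Real.exp (-(C₂ * N / 2)) → 0 < β → β < 1 →
      -- the random matrix
      ∀ (Ω : Type u) [MeasurableSpace Ω] (μ : Measure Ω) [IsProbabilityMeasure μ] (M : ℕ)
        (A : Ω → Matrix (Fin M) (Fin N) ℝ) (c₀ : ℝ) (c₁ : ℝ → ℝ),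
        0 < c₀ → IsSubgaussianMatrix μ c₀ A →
        0 < c₁ (δ / √2) → Concentrates μ A (δ / √2) (c₁ (δ / √2)) →
        (8 * K * ((k : ℝ) * Real.log (42 / δ) + Real.log (Real.exp 1 * J / (4 * K)))
          + Real.log (4 / β)) / c₁ (δ / √2) ≤ M →
      ∃ E : Set Ω, MeasurableSet E ∧ ENNReal.ofReal (1 - β) < μ E ∧
        ∀ ω ∈ E, ∀ (α' : EuclideanSpace ℂ (Fin J × Fin k)) (x' : EuclideanSpace ℂ (Fin N))
            (e y : EuclideanSpace ℂ (Fin M)),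
          IsBlockSparse K α' → x' = mulE Ψ α' → y = mulE (toComplex (A ω)) x' + e →
          ∀ (crit : StoppingCriterion (Fin M) (Fin J × Fin k)) (τ θ : ℝ),
            τ₀ ≤ τ → crit.IsAdequate ‖α'‖ ‖e‖ τ θ →
            -- the loop always terminates, and there is an output
            (∀ α : ℕ → EuclideanSpace ℂ (Fin J × Fin k),
              IsBBCoSaMPRun (toComplex (A ω) * Ψ)
                  (1 : Matrix (Fin J × Fin k) (Fin J × Fin k) ℂ) y K α →
                ∃ l, crit l (α l) (residual (toComplex (A ω) * Ψ) y (α l))) ∧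
            (∃ αhat, IsBBCoSaMPOutput crit (toComplex (A ω) * Ψ)
                (1 : Matrix (Fin J × Fin k) (Fin J × Fin k) ℂ) y K αhat) ∧
            -- every output is accurate
            ∀ αhat, IsBBCoSaMPOutput crit (toComplex (A ω) * Ψ)
                (1 : Matrix (Fin J × Fin k) (Fin J × Fin k) ℂ) y K αhat →
              ‖α' - αhat‖ ≤ κ₂ (δ + 6 * N * √C₁ * Real.exp (-(C₂ * N / 2))) θ * ‖e‖) := by
  refine ⟨⟨1, one_pos, fun W ε hW hW' hε hε' => exists_eigenvaluesNearOne hW hW' hε hε'⟩,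
    fun c₀ η hc hη => exists_concentrates hc hη,
    -- The hypothesis on `δ` forces the RIP constant below `1/10`, so one bound depending on `θ`
    -- alone serves.
    19, fun _ θ => 2 * |θ| + 20, by norm_num, fun _ θ => by linarith [abs_nonneg θ], ?_⟩
  intro Bnyq Bband Ts W ε J N k K hkN hnyq hband hJ hTs hTs' hW _ hε hε' hN hk hK hKJ C₁ C₂ N₀ hC₁
    _ hnear hN₀ lam s hs Ψ hΨ δ β hδ hδ' hβ hβ' Ω _ μ _ M A c₀ c₁ _ hA hc₁ hconc hM
  set γ := √C₁ * Real.exp (-(C₂ * N / 2)) with hγ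
  have hγ0 : 0 < γ := by positivity
  have hδγ : δ < 0.1 - 6 * (N * γ) := by rw [hγ]; linarith
  have hNγ : 0 < N * γ := by positivity
  have hk1 : 1 ≤ k := by
    have : (0 : ℝ) < k := by
      rw [hk, hW]
      have : 0 < 1 - ε := by linarith
      positivity
    exact_mod_cast this
  have hΛ : Real.log 420 ≤ Real.log (42 / δ) := by
    refine Real.log_le_log (by norm_num) ?_
    rw [le_div_iff₀ hδ]
    linarith
  have hcount := count_lt hK hKJ hk1 hΛ
  set X := 8 * (K : ℝ) * (k * Real.log (42 / δ) + Real.log (Real.exp 1 * J / (4 * K)))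
  -- The lower bound on `M` says exactly `c₁ M ≥ X + log (4/β)`.
  have htail : 4 * Real.exp (-(c₁ (δ / √2) * M)) ≤ β * Real.exp (-X) := by
    rw [div_le_iff₀ hc₁] at hM
    calc 4 * Real.exp (-(c₁ (δ / √2) * M))
        ≤ 4 * Real.exp (-Real.log (4 / β) + -X) := by gcongr; linarith
      _ = β * Real.exp (-X) := by
        rw [Real.exp_add, Real.exp_neg, Real.exp_log (by positivity)]
        field_simp
  have hprob : (J.choose (min (4 * K) J) * 125 ^ (2 * (min (4 * K) J * k)) : ℝ) *
      (4 * Real.exp (-(c₁ (δ / √2) * M))) < β :=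
    calc _ ≤ (J.choose (min (4 * K) J) * 125 ^ (2 * (min (4 * K) J * k)) : ℝ) *
          (β * Real.exp (-X)) := mul_le_mul_of_nonneg_left htail (by positivity)
      _ < Real.exp X * (β * Real.exp (-X)) := mul_lt_mul_of_pos_right hcount (by positivity)
      _ = β := by rw [mul_left_comm, ← Real.exp_add, add_neg_cancel, Real.exp_zero, mul_one]
  -- From `δ + 6Nγ < 0.1` follow both `2Nγ ≤ 0.05` and `δ + 2Nγ ≤ 1/10`. The order is capped at `J`
  -- because no set has more than `J` blocks.
  obtain ⟨E, hE, hμE, hRIP⟩ := hconc.exists_event_blockRIP hδ.le hA.measurable Ψ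
    (ρ := 2 * N * γ) (by linarith) (by linarith)
    (fun α => hΨ ▸ hs.abs_norm_sq_dpssDictionary_sub_le hkN hnyq hband hJ hTs hTs' hW hε hε' hN hk
      hC₁ hnear hN₀ α) (min_le_right _ _) hβ' hprob
  refine ⟨E, hE, hμE, fun ω hω α' x' e y hα' hx' hy crit τ θ hτ hcrit => ?_⟩
  have hB : BlockRIP (toComplex (A ω) * Ψ) (4 * K) (1 / 10) := fun I hI =>
    hRIP ω hω I (le_min hI (by simpa using Finset.card_le_univ I))
  have ha : ∃ S, S.card ≤ K ∧ SupportedOnBlocks S α' :=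
    let ⟨S, hS, hα⟩ := hα'
    ⟨S, hS.le, hα⟩
  have hy' : y = mulE (toComplex (A ω) * Ψ) α' + e := by rw [hy, hx', mulE_mul]
  exact ⟨fun _ hz => hB.terminates ha hy' hz hτ hcrit, hB.exists_output ha hy' hτ hcrit,
    fun _ hx => hB.output_error ha hy' hcrit hx⟩
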